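/- Let $d,N$ be nonnegative integers. Let $T^N(\mathbb{R}^d)=\bigoplus_{k=0}^N(\mathbb{R}^d)^{\otimes k}$ be the truncated tensor algebra, with the product $\pi_k(g\otimes h)=\sum_{i=0}^k \pi_i(g)\otimes\pi_{k-i}(h)$, $0\le k\le N$, where $\pi_k$ denotes the component in $(\mathbb{R}^d)^{\otimes k}$. Let $\mathfrak{t}^N(\mathbb{R}^d)=\{a:\pi_0(a)=0\}$, with the bracket $[a,b]=a\otimes b-b\otimes a$; let $\mathfrak{g}^N(\mathbb{R}^d)$ be the smallest Lie subalgebra of $\mathfrak{t}^N(\mathbb{R}^d)$ that contains $\mathbb{R}^d$ (the tensors of degree one), and let $\exp(a)=1+\sum_{k=1}^N a^{\otimes k}/k!$. The set $1+\mathfrak{t}^N(\mathbb{R}^d)$ is a Lie group under $\otimes$. Let $H^1([0,1],\mathbb{R}^d)$ be the set of absolutely continuous $x:[0,1]\to\mathbb{R}^d$ with $x(0)=0$ and $\dot x\in L^2([0,1],\mathbb{R}^d)$; such paths are continuous and of bounded variation. For a continuous path $x$ of bounded variation with $x(0)=0$ let $$S_N(x)_{s,t}=\Big(1,\int_{s\le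 u\le t}dx_u,\dots,\int_{s\le u_1\le\dots\le u_N\le t}dx_{u_1}\otimes\dots\otimes dx_{u_N}\Big)\in T^N(\mathbb{R}^d)$$ be its step-$N$ signature (iterated Stieltjes integrals). **Theorem.** Define $G^N(\mathbb{R}^d):=\{S_N(x)_{0,1}: x\in H^1([0,1],\mathbb{R}^d)\}$. Then $$G^N(\mathbb{R}^d)=\exp\big(\mathfrak{g}^N(\mathbb{R}^d)\big),$$ and $G^N(\mathbb{R}^d)$ is a closed Lie subgroup of $(1+\mathfrak{t}^N(\mathbb{R}^d),\otimes)$, i.e. it is a subgroup, it is closed, and with the subspace topology it carries a smooth structure for which it is a Lie group and the inclusion into $1+\mathfrak{t}^N(\mathbb{R}^d)$ is a smooth embedding. (It is called the free nilpotent group of order $N$.) -/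

import Mathlib

open MeasureTheory
open scoped Manifold ContDiff

namespace Signature

/-! ### The truncated tensor algebra -/

/-- Words of length at most `N` in the letters `0, …, d - 1`. The word `i₁ … iₖ` labels the basis
tensor `e_{i₁} ⊗ ⋯ ⊗ e_{iₖ}` of `(ℝ^d)^{⊗ k}`. -/
abbrev Word (d N : ℕ) : Type := {w : List (Fin d) // w.length ≤ N}

instance (d N : ℕ) : Finite (Word d N) := (List.finite_length_le (Fin d) N).to_subtype

noncomputable instance (d N : ℕ) : Fintype (Word d N) := Fintype.ofFinite _

namespace Word

variable {d N : ℕ}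

/-- The empty word. -/
def nil : Word d N := ⟨[], Nat.zero_le N⟩

/-- The first `i` letters of a word. -/
def take (i : ℕ) (w : Word d N) : Word d N :=
  ⟨w.1.take i, (List.length_take_le' i w.1).trans w.2⟩

/-- The word without its first `i` letters. -/
def drop (i : ℕ) (w : Word d N) : Word d N :=
  ⟨w.1.drop i, by have := w.2; simp only [List.length_drop]; omega⟩

end Word

/-- The truncated tensor algebra `T^N(ℝ^d) = ⨁_{k = 0}^N (ℝ^d)^{⊗ k}`: an element is given by its
coordinates in the basis of the tensors `e_{i₁} ⊗ ⋯ ⊗ e_{iₖ}`, `k ≤ N`. -/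
def TruncTensor (d N : ℕ) : Type := Word d N → ℝ

namespace TruncTensor

variable {d N : ℕ}

noncomputable instance : NormedAddCommGroup (TruncTensor d N) :=
  inferInstanceAs (NormedAddCommGroup (Word d N → ℝ))

noncomputable instance : NormedSpace ℝ (TruncTensor d N) :=
  inferInstanceAs (NormedSpace ℝ (Word d N → ℝ))

/-- The truncated tensor product `π_k (g ⊗ h) = ∑_{i = 0}^k π_i g ⊗ π_{k - i} h`, in
coordinates. -/
noncomputable instance : Mul (TruncTensor d N) :=
  ⟨fun g h w => ∑ i ∈ Finset.range (w.1.length + 1), g (w.take i) * h (w.drop i)⟩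

/-- The unit `(1, 0, …, 0)`. -/
noncomputable instance : One (TruncTensor d N) := ⟨fun w => if w.1 = [] then 1 else 0⟩

theorem mul_apply (g h : TruncTensor d N) (w : Word d N) :
    (g * h) w = ∑ i ∈ Finset.range (w.1.length + 1), g (w.take i) * h (w.drop i) := rfl

theorem one_apply (w : Word d N) :
    (1 : TruncTensor d N) w = if w.1 = [] then 1 else 0 := rfl

theorem add_apply (g h : TruncTensor d N) (w : Word d N) : (g + h) w = g w + h w := rfl

theorem smul_apply (c : ℝ) (g : TruncTensor d N) (w : Word d N) : (c • g) w = c * g w := rfl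

theorem zero_apply (w : Word d N) : (0 : TruncTensor d N) w = 0 := rfl

theorem sub_apply (g h : TruncTensor d N) (w : Word d N) : (g - h) w = g w - h w := rfl

theorem ext_apply {g h : TruncTensor d N} (H : ∀ w, g w = h w) : g = h := funext H

theorem mul_assoc_aux (a b c : TruncTensor d N) : a * b * c = a * (b * c) := by
  refine ext_apply fun w => ?_
  simp only [mul_apply, Finset.sum_mul, Finset.mul_sum]
  rw [Finset.sum_sigma', Finset.sum_sigma']
  refine Finset.sum_bij' (fun p _ => ⟨p.2, p.1 - p.2⟩) (fun p _ => ⟨p.1 + p.2, p.1⟩) ?_ ?_ ?_ ?_ ?_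
  · rintro ⟨i, j⟩ h
    simp only [Finset.mem_sigma, Finset.mem_range, Word.take, Word.drop, List.length_take,
      List.length_drop] at h ⊢
    omega
  · rintro ⟨i, j⟩ h
    simp only [Finset.mem_sigma, Finset.mem_range, Word.take, Word.drop, List.length_take,
      List.length_drop] at h ⊢
    omega
  · rintro ⟨i, j⟩ h
    simp only [Finset.mem_sigma, Finset.mem_range, Word.take, List.length_take] at h
    have : j + (i - j) = i := by omega
    simp [this]
  · rintro ⟨i, j⟩ h
    simp
  · rintro ⟨i, j⟩ h
    simp only [Finset.mem_sigma, Finset.mem_range, Word.take, List.length_take] at h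
    have h1 : min j i = j := by omega
    have h2 : j + (i - j) = i := by omega
    simp only [Word.take, Word.drop, List.take_take, List.drop_take, List.drop_drop, h1, h2,
      mul_assoc]

theorem one_mul_aux (a : TruncTensor d N) : 1 * a = a := by
  refine ext_apply fun w => ?_
  rw [mul_apply, Finset.sum_eq_single 0]
  · simp [one_apply, Word.take, Word.drop]
  · intro i hi hi0
    rw [Finset.mem_range] at hi
    have : w.1.take i ≠ [] := by
      intro h
      have := congrArg List.length h
      simp only [List.length_take, List.length_nil] at this
      omega
    simp [one_apply, Word.take, this]
  · simp

theorem mul_one_aux (a : TruncTensor d N) : a * 1 = a := by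
  refine ext_apply fun w => ?_
  rw [mul_apply, Finset.sum_eq_single w.1.length]
  · simp [one_apply, Word.take, Word.drop]
  · intro i hi hi0
    rw [Finset.mem_range] at hi
    have : w.1.drop i ≠ [] := by
      intro h
      have := congrArg List.length h
      simp only [List.length_drop, List.length_nil] at this
      omega
    simp [one_apply, Word.drop, this]
  · simp

noncomputable instance : Ring (TruncTensor d N) :=
  { (inferInstance : AddCommGroup (TruncTensor d N)) with
    mul := (· * ·)
    one := 1
    mul_assoc := mul_assoc_aux
    one_mul := one_mul_aux
    mul_one := mul_one_aux
    zero_mul := fun a => ext_apply fun w => by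
      simp [mul_apply, zero_apply]
    mul_zero := fun a => ext_apply fun w => by
      simp [mul_apply, zero_apply]
    left_distrib := fun a b c => ext_apply fun w => by
      simp [mul_apply, add_apply, mul_add, Finset.sum_add_distrib]
    right_distrib := fun a b c => ext_apply fun w => by
      simp [mul_apply, add_apply, add_mul, Finset.sum_add_distrib] }

noncomputable instance : Algebra ℝ (TruncTensor d N) :=
  Algebra.ofModule
    (fun r a b => ext_apply fun w => by
      simp [mul_apply, smul_apply, Finset.mul_sum, mul_assoc])
    (fun r a b => ext_apply fun w => by
      simp [mul_apply, smul_apply, Finset.mul_sum, mul_left_comm])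

/-- `T^N(ℝ^d)` is a Lie algebra for the bracket `[g, h] = g ⊗ h - h ⊗ g`. -/
noncomputable instance : LieRing (TruncTensor d N) := LieRing.ofAssociativeRing

noncomputable instance : LieAlgebra ℝ (TruncTensor d N) := LieAlgebra.ofAssociativeAlgebra

theorem bracket_def (g h : TruncTensor d N) : ⁅g, h⁆ = g * h - h * g := rfl

/-- The degree-zero part `T^N(ℝ^d) → ℝ`. -/
noncomputable def scalarPart : TruncTensor d N →ₗ[ℝ] ℝ where
  toFun g := g Word.nil
  map_add' _ _ := rfl
  map_smul' _ _ := rfl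

theorem scalarPart_mul (g h : TruncTensor d N) :
    scalarPart (g * h) = scalarPart g * scalarPart h := by
  simp [scalarPart, mul_apply, Word.nil, Word.take, Word.drop]

theorem scalarPart_one : scalarPart (1 : TruncTensor d N) = 1 := by
  simp [scalarPart, one_apply, Word.nil]

theorem pow_apply_of_length_lt {a : TruncTensor d N} (ha : scalarPart a = 0) (k : ℕ)
    (w : Word d N) (hw : w.1.length < k) : (a ^ k) w = 0 := by
  induction k generalizing w with
  | zero => omega
  | succ k ih =>
    rw [pow_succ', mul_apply]
    refine Finset.sum_eq_zero fun i _ => ?_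
    rcases Nat.eq_zero_or_pos i with rfl | hi
    · have : w.take 0 = Word.nil := by simp [Word.take, Word.nil]
      have h0 : a Word.nil = 0 := ha
      rw [this, h0, zero_mul]
    · by_cases h : w.1.length = 0
      · have : w.take i = Word.nil := by
          simp [Word.take, Word.nil, List.length_eq_zero_iff.mp h]
        have h0 : a Word.nil = 0 := ha
        rw [this, h0, zero_mul]
      · rw [ih (w.drop i) (by simp only [Word.drop, List.length_drop]; omega), mul_zero]

theorem pow_eq_zero_of_scalarPart {a : TruncTensor d N} (ha : scalarPart a = 0) :
    a ^ (N + 1) = 0 :=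
  ext_apply fun w => pow_apply_of_length_lt ha _ w (Nat.lt_succ_of_le w.2)

theorem contDiff_mul_aux :
    ContDiff ℝ ∞ fun p : TruncTensor d N × TruncTensor d N => p.1 * p.2 := by
  have key : ∀ v : Word d N, ContDiff ℝ ∞ fun g : TruncTensor d N => g v := fun v =>
    contDiff_apply ℝ ℝ v
  refine contDiff_pi' (E := TruncTensor d N × TruncTensor d N) (F' := fun _ : Word d N => ℝ)
    fun w => ?_
  change ContDiff ℝ ∞ fun p : TruncTensor d N × TruncTensor d N =>
    ∑ i ∈ Finset.range (w.1.length + 1), p.1 (w.take i) * p.2 (w.drop i)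
  exact ContDiff.sum fun i _ =>
    ((key _).comp contDiff_fst).mul ((key _).comp contDiff_snd)

/-- The basis vector `e_i` of `ℝ^d`, as an element of degree one. -/
noncomputable def letter (i : Fin d) : TruncTensor d N := fun w => if w.1 = [i] then 1 else 0

/-- The exponential `exp a = 1 + ∑_{k = 1}^N a^{⊗ k} / k!`. -/
noncomputable def texp (a : TruncTensor d N) : TruncTensor d N :=
  1 + ∑ k ∈ Finset.Icc 1 N, ((k.factorial : ℝ)⁻¹) • a ^ k

end TruncTensor

open TruncTensor

/-- `𝔱^N(ℝ^d)`: the tensors with vanishing degree-zero part. -/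
noncomputable def tangentSpace (d N : ℕ) : Submodule ℝ (TruncTensor d N) :=
  LinearMap.ker scalarPart

/-- `𝔤^N(ℝ^d)`: the smallest Lie subalgebra, for the bracket `[g, h] = g ⊗ h - h ⊗ g`, which
contains `ℝ^d`, i.e. the span of the tensors `e_i`. It lies in `𝔱^N(ℝ^d)`, see
`freeNilpotentLie_le`. -/
noncomputable def freeNilpotentLie (d N : ℕ) : LieSubalgebra ℝ (TruncTensor d N) :=
  LieSubalgebra.lieSpan ℝ (TruncTensor d N)
    (Submodule.span ℝ (Set.range (letter : Fin d → TruncTensor d N)) : Set (TruncTensor d N))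

theorem freeNilpotentLie_le (d N : ℕ) :
    (freeNilpotentLie d N : Set (TruncTensor d N)) ⊆ tangentSpace d N := by
  let K : LieSubalgebra ℝ (TruncTensor d N) :=
    { tangentSpace d N with
      lie_mem' := by
        intro a b ha hb
        change scalarPart (a * b - b * a) = 0
        rw [map_sub, scalarPart_mul, scalarPart_mul, mul_comm, sub_self] }
  have hK : freeNilpotentLie d N ≤ K := by
    refine LieSubalgebra.lieSpan_le.mpr ?_
    change (Submodule.span ℝ (Set.range (letter : Fin d → TruncTensor d N)) :
      Set (TruncTensor d N)) ⊆ (tangentSpace d N : Set (TruncTensor d N))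
    refine Submodule.span_le.mpr ?_
    rintro _ ⟨i, rfl⟩
    simp [tangentSpace, scalarPart, letter, Word.nil]
  exact hK

/-! ### The Lie group `1 + 𝔱^N(ℝ^d)` -/

/-- The set `1 + 𝔱^N(ℝ^d)` of tensors with degree-zero part `1`, with the topology induced by
`T^N(ℝ^d)`. -/
def UnitTensor (d N : ℕ) : Type := {g : TruncTensor d N // scalarPart g = 1}

namespace UnitTensor

variable {d N : ℕ}

noncomputable instance : TopologicalSpace (UnitTensor d N) :=
  inferInstanceAs (TopologicalSpace {g : TruncTensor d N // scalarPart g = 1})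

/-- The inclusion of `1 + 𝔱^N(ℝ^d)` into `T^N(ℝ^d)`. -/
def toTensor (g : UnitTensor d N) : TruncTensor d N := g.1

theorem scalarPart_one_sub (g : UnitTensor d N) : scalarPart (1 - g.1) = 0 := by
  rw [map_sub, scalarPart_one, g.2, sub_self]

theorem geom_mul (g : UnitTensor d N) :
    (∑ k ∈ Finset.range (N + 1), (1 - g.1) ^ k) * g.1 = 1 := by
  have := geom_sum_mul_neg (1 - g.1) (N + 1)
  rwa [pow_eq_zero_of_scalarPart (scalarPart_one_sub g), sub_sub_cancel, sub_zero] at this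

theorem scalarPart_geom (g : UnitTensor d N) :
    scalarPart (∑ k ∈ Finset.range (N + 1), (1 - g.1) ^ k) = 1 := by
  have := congrArg scalarPart (geom_mul g)
  rwa [scalarPart_mul, g.2, mul_one, scalarPart_one] at this

/-- `1 + 𝔱^N(ℝ^d)` is a group under `⊗`, with inverse `g⁻¹ = ∑_{k = 0}^N (1 - g)^{⊗ k}`. -/
noncomputable instance : Group (UnitTensor d N) where
  mul g h := ⟨g.1 * h.1, by rw [scalarPart_mul, g.2, h.2, mul_one]⟩
  one := ⟨1, scalarPart_one⟩
  inv g := ⟨∑ k ∈ Finset.range (N + 1), (1 - g.1) ^ k, scalarPart_geom g⟩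
  mul_assoc a b c := Subtype.ext (mul_assoc a.1 b.1 c.1)
  one_mul a := Subtype.ext (one_mul a.1)
  mul_one a := Subtype.ext (mul_one a.1)
  inv_mul_cancel a := Subtype.ext (geom_mul a)

/-- The global chart `g ↦ g - 1`. -/
noncomputable def chart (d N : ℕ) : UnitTensor d N ≃ₜ tangentSpace d N where
  toFun g := ⟨g.1 - 1, by
    change scalarPart (g.1 - 1) = 0
    rw [map_sub, scalarPart_one, g.2, sub_self]⟩
  invFun a := ⟨1 + a.1, by
    have : scalarPart a.1 = 0 := a.2
    rw [map_add, scalarPart_one, this, add_zero]⟩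
  left_inv g := Subtype.ext (add_sub_cancel 1 g.1)
  right_inv a := Subtype.ext (add_sub_cancel_left 1 a.1)
  continuous_toFun := (continuous_subtype_val.sub continuous_const).subtype_mk _
  continuous_invFun := (continuous_const.add continuous_subtype_val).subtype_mk _

noncomputable instance : ChartedSpace (tangentSpace d N) (UnitTensor d N) :=
  (chart d N).isOpenEmbedding.singletonChartedSpace

instance : IsManifold 𝓘(ℝ, tangentSpace d N) ∞ (UnitTensor d N) :=
  (chart d N).isOpenEmbedding.isManifold_singleton

theorem contMDiff_chart :
    ContMDiff 𝓘(ℝ, tangentSpace d N) 𝓘(ℝ, tangentSpace d N) ∞ (chart d N) :=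
  contMDiff_isOpenEmbedding (chart d N).isOpenEmbedding

theorem contMDiff_toTensor :
    ContMDiff 𝓘(ℝ, tangentSpace d N) 𝓘(ℝ, TruncTensor d N) ∞
      (toTensor : UnitTensor d N → TruncTensor d N) := by
  have h : ContDiff ℝ ∞ fun a : tangentSpace d N => (1 : TruncTensor d N) + a.1 :=
    contDiff_const.add (tangentSpace d N).subtypeL.contDiff
  have h2 := h.contMDiff.comp (contMDiff_chart (d := d) (N := N))
  exact h2.congr fun g => (add_sub_cancel 1 g.1).symm

/-- The linear projection of `T^N(ℝ^d)` onto `𝔱^N(ℝ^d)` which forgets the degree-zero part. -/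
noncomputable def proj (d N : ℕ) : TruncTensor d N →ₗ[ℝ] tangentSpace d N :=
  LinearMap.codRestrict (tangentSpace d N)
    (LinearMap.id - scalarPart.smulRight (1 : TruncTensor d N)) fun a => by
      change scalarPart (a - scalarPart a • (1 : TruncTensor d N)) = 0
      rw [map_sub, map_smul, scalarPart_one, smul_eq_mul, mul_one, sub_self]

instance : FiniteDimensional ℝ (TruncTensor d N) :=
  inferInstanceAs (FiniteDimensional ℝ (Word d N → ℝ))

theorem proj_val (g : UnitTensor d N) : proj d N g.1 = chart d N g :=
  Subtype.ext (by
    change g.1 - scalarPart g.1 • (1 : TruncTensor d N) = g.1 - 1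
    rw [g.2, one_smul])

theorem contMDiff_of_toTensor {E H M : Type*} [NormedAddCommGroup E] [NormedSpace ℝ E]
    [TopologicalSpace H] {I : ModelWithCorners ℝ E H} [TopologicalSpace M] [ChartedSpace H M]
    {f : M → UnitTensor d N}
    (hf : ContMDiff I 𝓘(ℝ, TruncTensor d N) ∞ fun x => toTensor (f x)) :
    ContMDiff I 𝓘(ℝ, tangentSpace d N) ∞ f := by
  refine ContMDiff.of_comp_isOpenEmbedding (chart d N).isOpenEmbedding ?_
  have h : ContMDiff I 𝓘(ℝ, tangentSpace d N) ∞
      fun x => LinearMap.toContinuousLinearMap (proj d N) (toTensor (f x)) :=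
    (LinearMap.toContinuousLinearMap (proj d N)).contDiff.contMDiff.comp hf
  exact h.congr fun x => (proj_val (f x)).symm

theorem contDiff_pow_aux (k : ℕ) : ContDiff ℝ ∞ fun a : TruncTensor d N => a ^ k := by
  induction k with
  | zero => simpa only [pow_zero] using contDiff_const
  | succ k ih =>
    simp only [pow_succ]
    exact contDiff_mul_aux.comp (ih.prodMk contDiff_id)

/-- `(1 + 𝔱^N(ℝ^d), ⊗)` is a Lie group. -/
instance : LieGroup 𝓘(ℝ, tangentSpace d N) ∞ (UnitTensor d N) where
  contMDiff_mul := by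
    refine contMDiff_of_toTensor ?_
    exact (contDiff_mul_aux (d := d) (N := N)).contMDiff.comp
      ((contMDiff_toTensor.comp contMDiff_fst).prodMk_space (contMDiff_toTensor.comp contMDiff_snd))
  contMDiff_inv := by
    refine contMDiff_of_toTensor ?_
    have h : ContDiff ℝ ∞ fun a : TruncTensor d N =>
        ∑ k ∈ Finset.range (N + 1), (1 - a) ^ k :=
      ContDiff.sum fun k _ => (contDiff_pow_aux k).comp (contDiff_const.sub contDiff_id)
    exact h.contMDiff.comp contMDiff_toTensor

end UnitTensor

/-- A closed Lie subgroup of a (real) Lie group: a subgroup which is closed and carries a smooth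
structure, compatible with the subspace topology, for which it is a finite-dimensional Lie group
and the inclusion is a smooth embedding. -/
def IsClosedLieSubgroup {E H G : Type*} [NormedAddCommGroup E] [NormedSpace ℝ E]
    [TopologicalSpace H] (I : ModelWithCorners ℝ E H) [Group G] [TopologicalSpace G]
    [ChartedSpace H G] [LieGroup I ∞ G] (S : Subgroup G) : Prop :=
  IsClosed (S : Set G) ∧
    ∃ (n : ℕ) (_ : ChartedSpace (EuclideanSpace ℝ (Fin n)) S),
      LieGroup (𝓡 n) ∞ S ∧ Manifold.IsSmoothEmbedding (𝓡 n) I ∞ (Subtype.val : S → G)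

/-! ### Paths and their signatures -/

/-- Continuous paths `[0, 1] → ℝ^d`. -/
abbrev Path (d : ℕ) : Type := C(Set.Icc (0 : ℝ) 1, EuclideanSpace ℝ (Fin d))

/-- `BV([0, 1], ℝ^d)`: continuous paths of bounded variation which start at `0`. -/
def BV (d : ℕ) : Set (Path d) := {x | x 0 = 0 ∧ BoundedVariationOn x Set.univ}

/-- `H¹([0, 1], ℝ^d)`: the absolutely continuous paths which start at `0` and whose derivative
(which exists almost everywhere) is square integrable. The path is extended to `ℝ` by constants;
the values outside `[0, 1]` play no role. -/
def H1 (d : ℕ) : Set (Path d) :=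
  {x | x 0 = 0 ∧
    AbsolutelyContinuousOnInterval (Set.IccExtend zero_le_one x) 0 1 ∧
    MemLp (deriv (Set.IccExtend zero_le_one x)) 2 (volume.restrict (Set.Icc 0 1))}

theorem H1_subset_BV (d : ℕ) : H1 d ⊆ BV d := by
  rintro x ⟨h0, hac, -⟩
  refine ⟨h0, ?_⟩
  have h := hac.boundedVariationOn
  rw [Set.uIcc_of_le zero_le_one] at h
  have h2 := eVariationOn.comp_le_of_monotoneOn (Set.IccExtend zero_le_one x)
    (s := Set.Icc (0 : ℝ) 1) (t := Set.univ) (Subtype.val : Set.Icc (0 : ℝ) 1 → ℝ)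
    (fun _ _ _ _ hab => hab) (fun t _ => t.2)
  have h3 : Set.IccExtend zero_le_one x ∘ (Subtype.val : Set.Icc (0 : ℝ) 1 → ℝ) = x :=
    funext fun t => Set.IccExtend_val _ _ t
  rw [h3] at h2
  exact ne_top_of_le_ne_top h h2

theorem boundedVariationOn_coord {d : ℕ} {x : Path d} (hx : x ∈ BV d) (i : Fin d) :
    BoundedVariationOn (fun t => x t i) Set.univ :=
  (EuclideanSpace.proj i : EuclideanSpace ℝ (Fin d) →L[ℝ] ℝ).lipschitz.comp_boundedVariationOn
    hx.2

/-- The signed Lebesgue–Stieltjes measure `dx^i` on `[0, 1]` of the `i`-th coordinate of a path of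
bounded variation. -/
noncomputable def dcoord {d : ℕ} (x : BV d) (i : Fin d) : SignedMeasure (Set.Icc (0 : ℝ) 1) :=
  (boundedVariationOn_coord x.2 i).vectorMeasure

/-- The iterated integrals, with the letters of the word listed from the last to the first:
`iterInt x s [iₖ, …, i₁] t = ∫_{s ≤ u₁ ≤ ⋯ ≤ uₖ ≤ t} dx^{i₁}_{u₁} ⋯ dx^{iₖ}_{uₖ}`. -/
noncomputable def iterInt {d : ℕ} (x : BV d) (s : Set.Icc (0 : ℝ) 1) :
    List (Fin d) → Set.Icc (0 : ℝ) 1 → ℝ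
  | [], _ => 1
  | i :: w, t => ∫ᵛ u in Set.Icc s t, iterInt x s w u ∂•(dcoord x i)

/-- The step-`N` signature `S_N(x)_{s,t}`: its coordinate at the word `i₁ … iₖ` is
`∫_{s ≤ u₁ ≤ ⋯ ≤ uₖ ≤ t} dx^{i₁}_{u₁} ⋯ dx^{iₖ}_{uₖ}`. -/
noncomputable def signature {d : ℕ} (N : ℕ) (x : BV d) (s t : Set.Icc (0 : ℝ) 1) :
    TruncTensor d N :=
  fun w => iterInt x s w.1.reverse t

/-- `G^N(ℝ^d) = {S_N(x)_{0,1} : x ∈ H¹([0, 1], ℝ^d)}`. -/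
def signatureSet (d N : ℕ) : Set (TruncTensor d N) :=
  {g | ∃ (x : Path d) (hx : x ∈ H1 d), g = signature N ⟨x, H1_subset_BV d hx⟩ 0 1}

end Signature

/-!
Write `𝔤 = freeNilpotentLie d N`, let `E` be the Euler derivation `TruncTensor.euler`, which
multiplies the component of degree `k` by `k`, and attach to an element `S` of `1 + 𝔱^N(ℝ^d)` its
logarithmic derivative `u = S⁻¹ ⊗ E S` (`UnitTensor.logEuler`). The elements with `u ∈ 𝔤` are
at the same time the exponentials of `𝔤`, the finite products of tensors `exp (c e_i)`
(`segmentGroup`) and the signatures of paths in `H¹`.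

* If `S` moves along `S' = S ⊗ v` with `v ∈ 𝔤`, then `u' = E v + [u, v]`. As `𝔤` is graded and `v`
  has no component of degree zero, the component of degree `k` of `u'` is in `𝔤` once the lower
  components of `u` are, so that `u` stays in `𝔤`: `logEuler_mem_of_hasDerivAt`. The equation
  `S' = S ⊗ x'` of the signature gives `logEuler_sigFun_mem`; the equation of
  `s ↦ S ⊗ exp (s z)` shows that `u ∈ 𝔤` is stable under multiplication by `exp 𝔤`. For the former,
  the Stieltjes integrals are turned into Lebesgue integrals (`dcoord_eq_withDensity`).
* If `u ∈ 𝔤` and `S - 1` starts in degree `k`, then its component of degree `k` is that of `u / k`,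
  hence in `𝔤`. Removing it by a factor in `exp 𝔤` and continuing with `k + 1` gives `S ∈ exp 𝔤`
  (`exists_texp_eq_of_logEuler_mem`). It can equally be removed by a product of tensors
  `exp (c e_i)`, since the group commutator has as its leading part the bracket of the leading
  parts (`leadingParts_lie`, `homPart_mem_leadingParts`); hence
  `mem_segmentGroup_of_logEuler_mem`.
* A product of tensors `exp (c e_i)` is the signature of the piecewise linear path which runs
  through the segments `c e_i` one after the other: `exists_path_of_mem_segmentGroup`.

The logarithm is a global chart of `1 + 𝔱^N(ℝ^d)` (`UnitTensor.logHomeo`) which maps the group to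
the linear subspace `𝔤` of `𝔱^N(ℝ^d)`. The group is therefore closed, the chart restricts to a
global chart of it, and multiplication, inversion and inclusion are smooth because they are so in
the ambient group (`isClosedLieSubgroup_of_globalChart`).
-/

namespace Signature

/-! ### Integrals against signed measures with a density -/

section

theorem setIntegral_toSignedMeasure_lsmul {X : Type*} {mX : MeasurableSpace X} {ν : Measure X}
    [IsFiniteMeasure ν] {φ : X → ℝ} {s : Set X} (hs : MeasurableSet s) :
    ∫ᵛ x in s, φ x ∂•ν.toSignedMeasure = ∫ x in s, φ x ∂ν := by
  have : ContinuousLinearMap.lsmul ℝ ℝ = (ContinuousLinearMap.lsmul ℝ ℝ (E := ℝ)).flip := by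
    ext; simp
  rw [this, VectorMeasure.setIntegral_toSignedMeasure hs]

/-- The integral of a bounded function against a signed measure with density `f` is the integral of
its product with `f`: the signed measure is the difference of the measures with densities `f⁺` and
`f⁻`. -/
theorem setIntegral_withDensityᵥ {X : Type*} {mX : MeasurableSpace X} {μ : Measure X}
    {f φ : X → ℝ} (hf : Integrable f μ) (hφ : Measurable φ) {C : ℝ} (hb : ∀ x, ‖φ x‖ ≤ C)
    {s : Set X} (hs : MeasurableSet s) :
    ∫ᵛ x in s, φ x ∂•(μ.withDensityᵥ f) = ∫ x in s, φ x * f x ∂μ := by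
  have key : ∀ g : X → ℝ, Integrable g μ → ∃ _ : IsFiniteMeasure
      (μ.withDensity fun x => ENNReal.ofReal (g x)),
      (μ.withDensity fun x => ENNReal.ofReal (g x)).toSignedMeasure.Integrable φ ∧
      ∫ᵛ x in s, φ x ∂•(μ.withDensity fun x => ENNReal.ofReal (g x)).toSignedMeasure =
        ∫ x in s, φ x * max (g x) 0 ∂μ := by
    intro g hg
    have hfin : IsFiniteMeasure (μ.withDensity fun x => ENNReal.ofReal (g x)) :=
      isFiniteMeasure_withDensity_ofReal hg.2
    refine ⟨hfin, ?_, ?_⟩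
    · rw [VectorMeasure.Integrable, Measure.variation_toSignedMeasure]
      exact Integrable.of_bound hφ.aestronglyMeasurable C (Filter.Eventually.of_forall hb)
    · rw [setIntegral_toSignedMeasure_lsmul hs, restrict_withDensity hs,
        integral_withDensity_eq_integral_toReal_smul₀ (by
          exact hg.1.aemeasurable.restrict.ennreal_ofReal)
          (Filter.Eventually.of_forall fun x => ENNReal.ofReal_lt_top)]
      refine integral_congr_ae (Filter.Eventually.of_forall fun x => ?_)
      simp only [ENNReal.toReal_ofReal', smul_eq_mul, mul_comm]
  obtain ⟨h1, h1i, h1e⟩ := key f hf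
  obtain ⟨h2, h2i, h2e⟩ := key (fun x => - f x) hf.neg
  rw [withDensityᵥ_eq_withDensity_pos_part_sub_withDensity_neg_part hf]
  have hr : ∀ ν ν' : SignedMeasure X, (ν - ν').restrict s = ν.restrict s - ν'.restrict s := by
    intro ν ν'
    rw [sub_eq_add_neg, sub_eq_add_neg, VectorMeasure.restrict_add, VectorMeasure.restrict_neg]
  rw [hr, VectorMeasure.integral_sub_vectorMeasure h1i.restrict h2i.restrict, h1e, h2e,
    ← integral_sub]
  · refine integral_congr_ae (Filter.Eventually.of_forall fun x => ?_)
    change φ x * max (f x) 0 - φ x * max (-f x) 0 = φ x * f x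
    rw [← mul_sub]
    congr 1
    rcases le_total (f x) 0 with h | h
    · rw [max_eq_right h, max_eq_left (by linarith)]; ring
    · rw [max_eq_left h, max_eq_right (by linarith)]; ring
  · exact (hf.pos_part.bdd_mul hφ.aestronglyMeasurable
      (Filter.Eventually.of_forall hb)).restrict
  · exact (hf.neg_part.bdd_mul hφ.aestronglyMeasurable
      (Filter.Eventually.of_forall hb)).restrict

end

/-! ### Iterated Stieltjes integrals of absolutely continuous paths -/

section

/-- The `i`-th coordinate of a path, extended to `ℝ` by constants. -/
noncomputable def coordExt {d : ℕ} (x : Path d) (i : Fin d) (τ : ℝ) : ℝ :=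
  Set.IccExtend zero_le_one x τ i

theorem coordExt_val {d : ℕ} (x : Path d) (i : Fin d) (t : Set.Icc (0 : ℝ) 1) :
    coordExt x i t = x t i := by
  simp [coordExt]

theorem absolutelyContinuous_coordExt {d : ℕ} {x : Path d}
    (hx : AbsolutelyContinuousOnInterval (Set.IccExtend zero_le_one x) 0 1) (i : Fin d) :
    AbsolutelyContinuousOnInterval (coordExt x i) 0 1 := by
  rw [absolutelyContinuousOnInterval_iff] at hx ⊢
  intro ε hε
  obtain ⟨δ, hδ, h⟩ := hx ε hε
  refine ⟨δ, hδ, fun E hE hl => lt_of_le_of_lt (Finset.sum_le_sum fun j _ => ?_) (h E hE hl)⟩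
  rw [dist_eq_norm, dist_eq_norm]
  exact PiLp.norm_apply_le (Set.IccExtend zero_le_one x (E.2 j).1 -
    Set.IccExtend zero_le_one x (E.2 j).2) i

theorem integral_comap_Icc (g : ℝ → ℝ) (t : Set.Icc (0 : ℝ) 1) :
    ∫ u in Set.Icc 0 t, g u ∂((volume : Measure ℝ).comap (Subtype.val : Set.Icc (0 : ℝ) 1 → ℝ)) =
      ∫ u in (0 : ℝ)..t, g u := by
  have he := MeasurableEmbedding.subtype_coe (measurableSet_Icc (a := (0 : ℝ)) (b := 1))
  rw [he.restrict_comap, integral_subtype_comap measurableSet_Icc,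
    intervalIntegral.integral_of_le t.2.1, ← integral_Icc_eq_integral_Ioc,
    Measure.restrict_restrict measurableSet_Icc]
  congr 2
  ext u
  simp only [Set.mem_inter_iff, Set.mem_Icc, Set.mem_image, Subtype.exists, exists_and_right,
    exists_eq_right]
  constructor
  · rintro ⟨-, h, h1, h2⟩; exact ⟨h1, h2⟩
  · rintro ⟨h1, h2⟩; exact ⟨⟨h1, h2.trans t.2.2⟩, ⟨h1, h2.trans t.2.2⟩, h1, h2⟩

theorem integrable_deriv_coordExt {d : ℕ} {x : Path d}
    (hx : AbsolutelyContinuousOnInterval (Set.IccExtend zero_le_one x) 0 1) (i : Fin d) :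
    Integrable (fun u : Set.Icc (0 : ℝ) 1 => deriv (coordExt x i) u)
      ((volume : Measure ℝ).comap Subtype.val) := by
  have h := (absolutelyContinuous_coordExt hx i).intervalIntegrable_deriv
  rw [intervalIntegrable_iff_integrableOn_Icc_of_le zero_le_one,
    integrableOn_iff_comap_subtypeVal measurableSet_Icc] at h
  exact h

/-- The Stieltjes measure of an absolutely continuous coordinate has the derivative as its
density. -/
theorem dcoord_eq_withDensity {d : ℕ} (x : BV d)
    (hx : AbsolutelyContinuousOnInterval (Set.IccExtend zero_le_one x.1) 0 1) (i : Fin d) :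
    dcoord x i = ((volume : Measure ℝ).comap Subtype.val).withDensityᵥ
      fun u : Set.Icc (0 : ℝ) 1 => deriv (coordExt x.1 i) u := by
  have hI : ∀ t : Set.Icc (0 : ℝ) 1, dcoord x i (Set.Icc 0 t) =
      ((volume : Measure ℝ).comap Subtype.val).withDensityᵥ
        (fun u : Set.Icc (0 : ℝ) 1 => deriv (coordExt x.1 i) u) (Set.Icc 0 t) := by
    intro t
    have hc : Continuous fun t => x.1 t i :=
      (EuclideanSpace.proj i : EuclideanSpace ℝ (Fin d) →L[ℝ] ℝ).continuous.comp x.1.continuous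
    rw [withDensityᵥ_apply (integrable_deriv_coordExt hx i) measurableSet_Icc,
      integral_comap_Icc (fun u => deriv (coordExt x.1 i) u) t, dcoord,
      BoundedVariationOn.vectorMeasure_Icc _ (show (0 : Set.Icc (0 : ℝ) 1) ≤ t from t.2.1),
      hc.continuousAt.continuousWithinAt.rightLim_eq,
      hc.continuousAt.continuousWithinAt.leftLim_eq]
    have := ((absolutelyContinuous_coordExt hx i).mono (c := 0) (d := t) (by
      rw [Set.uIcc_of_le zero_le_one, Set.uIcc_of_le t.2.1]
      exact Set.Icc_subset_Icc_right t.2.2)).integral_deriv_eq_sub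
    rw [this, coordExt_val]
    congr 1
    exact (coordExt_val x.1 i 0).symm
  have hgen : (inferInstance : MeasurableSpace (Set.Icc (0 : ℝ) 1)) =
      MeasurableSpace.generateFrom (Set.range Set.Iic) :=
    BorelSpace.measurable_eq.trans (borel_eq_generateFrom_Iic _)
  refine VectorMeasure.ext_of_generateFrom (Set.range Set.Iic) ?_ hgen isPiSystem_Iic ?_
  · rintro _ ⟨t, rfl⟩
    have : Set.Iic t = Set.Icc 0 t := by ext u; simp
    rw [this, hI]
  · have : Set.univ = Set.Icc (0 : Set.Icc (0 : ℝ) 1) 1 := by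
      ext u; exact iff_of_true trivial ⟨u.2.1, u.2.2⟩
    rw [this, hI]

/-- The iterated integrals of an absolutely continuous path, as functions of time on `ℝ`. -/
noncomputable def iterFun {d : ℕ} (x : BV d) (w : List (Fin d)) (τ : ℝ) : ℝ :=
  iterInt x 0 w (Set.projIcc 0 1 zero_le_one τ)

theorem iterInt_cons_of_continuous {d : ℕ} (x : BV d)
    (hx : AbsolutelyContinuousOnInterval (Set.IccExtend zero_le_one x.1) 0 1) (i : Fin d)
    (w : List (Fin d)) (hw : Continuous (iterInt x 0 w)) (t : Set.Icc (0 : ℝ) 1) :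
    iterInt x 0 (i :: w) t = ∫ u in (0 : ℝ)..t, iterFun x w u * deriv (coordExt x.1 i) u := by
  obtain ⟨C, hC⟩ := isCompact_univ.exists_bound_of_continuousOn hw.continuousOn
  rw [iterInt, dcoord_eq_withDensity x hx, setIntegral_withDensityᵥ
    (integrable_deriv_coordExt hx i) hw.measurable (fun u => hC u (Set.mem_univ u))
    measurableSet_Icc, ← integral_comap_Icc]
  simp [iterFun]

theorem continuous_iterInt {d : ℕ} (x : BV d)
    (hx : AbsolutelyContinuousOnInterval (Set.IccExtend zero_le_one x.1) 0 1)
    (w : List (Fin d)) : Continuous (iterInt x 0 w) := by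
  induction w with
  | nil => exact continuous_const
  | cons i w ih =>
    have hI : IntervalIntegrable (fun u => iterFun x w u * deriv (coordExt x.1 i) u)
        volume 0 1 :=
      (absolutelyContinuous_coordExt hx i).intervalIntegrable_deriv.continuousOn_mul
        (ih.comp continuous_projIcc).continuousOn
    have hc := intervalIntegral.continuousOn_primitive_interval' hI Set.left_mem_uIcc
    rw [Set.uIcc_of_le zero_le_one, continuousOn_iff_continuous_domRestrict] at hc
    exact hc.congr fun t => (iterInt_cons_of_continuous x hx i w ih t).symm

theorem continuous_iterFun {d : ℕ} (x : BV d)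
    (hx : AbsolutelyContinuousOnInterval (Set.IccExtend zero_le_one x.1) 0 1)
    (w : List (Fin d)) : Continuous (iterFun x w) :=
  (continuous_iterInt x hx w).comp continuous_projIcc

/-- For an absolutely continuous path the iterated Stieltjes integrals are iterated Lebesgue
integrals against the derivative of the path. -/
theorem iterFun_cons {d : ℕ} (x : BV d)
    (hx : AbsolutelyContinuousOnInterval (Set.IccExtend zero_le_one x.1) 0 1) (i : Fin d)
    (w : List (Fin d)) {τ : ℝ} (hτ : τ ∈ Set.Icc (0 : ℝ) 1) :
    iterFun x (i :: w) τ = ∫ u in (0 : ℝ)..τ, iterFun x w u * deriv (coordExt x.1 i) u := by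
  have := iterInt_cons_of_continuous x hx i w (continuous_iterInt x hx w) ⟨τ, hτ⟩
  rwa [iterFun, Set.projIcc_of_mem zero_le_one hτ]

end

/-! ### Degrees, the Euler derivation and the grading of the free nilpotent Lie algebra -/

section

namespace TruncTensor

variable {d N : ℕ}

theorem sum_apply {ι : Type*} (s : Finset ι) (f : ι → TruncTensor d N) (w : Word d N) :
    (∑ i ∈ s, f i) w = ∑ i ∈ s, f i w :=
  Finset.sum_apply w s f

/-- The tensors all of whose components of degree less than `k` vanish. -/
def degGE (d N k : ℕ) : Submodule ℝ (TruncTensor d N) where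
  carrier := {a | ∀ w : Word d N, w.1.length < k → a w = 0}
  add_mem' ha hb w hw := by rw [add_apply, ha w hw, hb w hw, add_zero]
  zero_mem' _ _ := rfl
  smul_mem' c a ha w hw := by rw [smul_apply, ha w hw, mul_zero]

theorem degGE_zero (a : TruncTensor d N) : a ∈ degGE d N 0 := fun _ h => absurd h (by omega)

theorem degGE_anti {k l : ℕ} (h : k ≤ l) {a : TruncTensor d N} (ha : a ∈ degGE d N l) :
    a ∈ degGE d N k := fun w hw => ha w (hw.trans_le h)

theorem eq_zero_of_mem_degGE {k : ℕ} (hk : N < k) {a : TruncTensor d N}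
    (ha : a ∈ degGE d N k) : a = 0 :=
  ext_apply fun w => ha w (w.2.trans_lt hk)

theorem mem_degGE_one {a : TruncTensor d N} : a ∈ degGE d N 1 ↔ scalarPart a = 0 := by
  refine ⟨fun h => h Word.nil (by simp [Word.nil]), fun h w hw => ?_⟩
  have : w = Word.nil := Subtype.ext (List.length_eq_zero_iff.1 (by omega))
  rw [this]; exact h

theorem mul_mem_degGE {k l : ℕ} {a b : TruncTensor d N} (ha : a ∈ degGE d N k)
    (hb : b ∈ degGE d N l) : a * b ∈ degGE d N (k + l) := by
  intro w hw
  rw [mul_apply]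
  refine Finset.sum_eq_zero fun i hi => ?_
  rw [Finset.mem_range] at hi
  by_cases h : i < k
  · rw [ha _ (by simp only [Word.take, List.length_take]; omega), zero_mul]
  · rw [hb _ (by simp only [Word.drop, List.length_drop]; omega), mul_zero]

theorem mul_mem_degGE_left {k : ℕ} {a : TruncTensor d N} (ha : a ∈ degGE d N k)
    (b : TruncTensor d N) : a * b ∈ degGE d N k :=
  mul_mem_degGE ha (degGE_zero b)

theorem mul_mem_degGE_right {k : ℕ} {b : TruncTensor d N} (a : TruncTensor d N)
    (hb : b ∈ degGE d N k) : a * b ∈ degGE d N k := by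
  simpa using mul_mem_degGE (degGE_zero a) hb

theorem pow_mem_degGE {a : TruncTensor d N} (ha : a ∈ degGE d N 1) (n : ℕ) :
    a ^ n ∈ degGE d N n :=
  fun w hw => pow_apply_of_length_lt (mem_degGE_one.1 ha) n w hw

/-- The component of degree `k` of a tensor. -/
def homPart (k : ℕ) : TruncTensor d N →ₗ[ℝ] TruncTensor d N where
  toFun a w := if w.1.length = k then a w else 0
  map_add' a b := ext_apply fun w => by
    change (if w.1.length = k then a w + b w else 0) =
      (if w.1.length = k then a w else 0) + if w.1.length = k then b w else 0
    split_ifs <;> simp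
  map_smul' c a := ext_apply fun w => by
    change (if w.1.length = k then c * a w else 0) = c * if w.1.length = k then a w else 0
    split_ifs <;> simp

theorem homPart_apply (k : ℕ) (a : TruncTensor d N) (w : Word d N) :
    homPart k a w = if w.1.length = k then a w else 0 := rfl

theorem homPart_mem_degGE (k : ℕ) (a : TruncTensor d N) : homPart k a ∈ degGE d N k :=
  fun w hw => by rw [homPart_apply, if_neg hw.ne]

theorem homPart_eq_zero {k l : ℕ} {a : TruncTensor d N} (ha : a ∈ degGE d N l) (h : k < l) :
    homPart k a = 0 :=
  ext_apply fun w => by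
    rw [homPart_apply]; split_ifs with hw
    · exact ha w (by omega)
    · rfl

theorem homPart_homPart_self (k : ℕ) (a : TruncTensor d N) :
    homPart k (homPart k a) = homPart k a :=
  ext_apply fun w => by
    simp only [homPart_apply]; split_ifs <;> rfl

theorem sub_homPart_mem_degGE {k : ℕ} {a : TruncTensor d N} (ha : a ∈ degGE d N k) :
    a - homPart k a ∈ degGE d N (k + 1) := fun w hw => by
  rw [sub_apply, homPart_apply]
  split_ifs with h
  · exact sub_self _
  · rw [ha w (by omega), sub_zero]

theorem sum_homPart (a : TruncTensor d N) : ∑ k ∈ Finset.range (N + 1), homPart k a = a :=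
  ext_apply fun w => by
    rw [sum_apply, Finset.sum_eq_single w.1.length]
    · rw [homPart_apply, if_pos rfl]
    · intro k _ hk; rw [homPart_apply, if_neg hk.symm]
    · intro h; exact absurd (Finset.mem_range.2 (Nat.lt_succ_of_le w.2)) h

theorem homPart_mul (k : ℕ) (a b : TruncTensor d N) :
    homPart k (a * b) = ∑ i ∈ Finset.range (k + 1), homPart i a * homPart (k - i) b := by
  refine ext_apply fun w => ?_
  rw [sum_apply, homPart_apply]
  simp only [mul_apply, homPart_apply, Word.take, Word.drop, List.length_take, List.length_drop]
  split_ifs with h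
  · rw [h]
    refine Finset.sum_congr rfl fun i hi => ?_
    rw [Finset.mem_range] at hi
    rw [Finset.sum_eq_single i]
    · rw [if_pos (by omega), if_pos rfl]
    · intro j hj hji
      rw [Finset.mem_range] at hj
      rw [if_neg (by omega), zero_mul]
    · intro hi'; exact absurd (Finset.mem_range.2 hi) hi'
  · symm
    refine Finset.sum_eq_zero fun i hi => Finset.sum_eq_zero fun j hj => ?_
    rw [Finset.mem_range] at hi hj
    by_cases h1 : min j w.1.length = i
    · rw [if_neg (c := w.1.length - j = k - i) (by omega), mul_zero]
    · rw [if_neg h1, zero_mul]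

theorem homPart_lie (k : ℕ) (a b : TruncTensor d N) :
    homPart k ⁅a, b⁆ = ∑ i ∈ Finset.range (k + 1), ⁅homPart i a, homPart (k - i) b⁆ := by
  simp only [bracket_def, map_sub, homPart_mul, Finset.sum_sub_distrib]
  congr 1
  rw [← Finset.sum_range_reflect]
  refine Finset.sum_congr rfl fun i hi => ?_
  rw [Finset.mem_range] at hi
  rw [show k + 1 - 1 - i = k - i by omega, show k - (k - i) = i by omega]

theorem homPart_letter (k : ℕ) (i : Fin d) :
    homPart k (letter i : TruncTensor d N) = if k = 1 then letter i else 0 := by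
  refine ext_apply fun w => ?_
  rw [homPart_apply]
  by_cases hw : w.1 = [i]
  · have hl : w.1.length = 1 := by rw [hw]; rfl
    by_cases hk : k = 1
    · rw [if_pos (by omega), if_pos hk]
    · rw [if_neg (by omega), if_neg hk]; rfl
  · have h0 : (letter i : TruncTensor d N) w = 0 := if_neg hw
    split_ifs <;> first | exact h0 | rfl | exact h0.symm

/-- The Euler derivation, which multiplies the component of degree `k` by `k`. -/
def euler : TruncTensor d N →ₗ[ℝ] TruncTensor d N where
  toFun a w := w.1.length * a w
  map_add' a b := ext_apply fun w => mul_add (w.1.length : ℝ) (a w) (b w)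
  map_smul' c a := ext_apply fun w => mul_left_comm (w.1.length : ℝ) c (a w)

theorem euler_apply (a : TruncTensor d N) (w : Word d N) : euler a w = w.1.length * a w := rfl

theorem euler_mul (a b : TruncTensor d N) : euler (a * b) = euler a * b + a * euler b := by
  refine ext_apply fun w => ?_
  rw [euler_apply, add_apply]
  simp only [mul_apply, euler_apply, Finset.mul_sum, ← Finset.sum_add_distrib]
  refine Finset.sum_congr rfl fun i hi => ?_
  rw [Finset.mem_range] at hi
  have : (w.1.length : ℝ) = (w.take i).1.length + (w.drop i).1.length := by
    rw [← Nat.cast_add]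
    congr 1
    simp only [Word.take, Word.drop, List.length_take, List.length_drop]; omega
  rw [this]; ring

theorem euler_one : euler (1 : TruncTensor d N) = 0 :=
  ext_apply fun w => by
    rw [euler_apply, one_apply, zero_apply]
    split_ifs with h
    · simp [h]
    · simp

theorem homPart_euler (k : ℕ) (a : TruncTensor d N) :
    homPart k (euler a) = (k : ℝ) • homPart k a :=
  ext_apply fun w => by
    rw [smul_apply, homPart_apply, homPart_apply, euler_apply]
    split_ifs with h
    · rw [h]
    · rw [mul_zero]

theorem euler_mem_degGE {k : ℕ} {a : TruncTensor d N} (ha : a ∈ degGE d N k) :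
    euler a ∈ degGE d N k := fun w hw => by rw [euler_apply, ha w hw, mul_zero]

end TruncTensor

open TruncTensor

variable {d N : ℕ}

theorem letter_mem_freeNilpotentLie (i : Fin d) :
    (letter i : TruncTensor d N) ∈ freeNilpotentLie d N :=
  LieSubalgebra.subset_lieSpan (Submodule.subset_span ⟨i, rfl⟩)

theorem freeNilpotentLie_le_of_letter {K : LieSubalgebra ℝ (TruncTensor d N)}
    (h : ∀ i, letter i ∈ K) : freeNilpotentLie d N ≤ K := by
  refine LieSubalgebra.lieSpan_le.mpr ?_
  have : Submodule.span ℝ (Set.range (letter : Fin d → TruncTensor d N)) ≤ K.toSubmodule :=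
    Submodule.span_le.mpr (by rintro _ ⟨i, rfl⟩; exact h i)
  exact this

theorem mem_degGE_one_of_mem {a : TruncTensor d N} (ha : a ∈ freeNilpotentLie d N) :
    a ∈ degGE d N 1 :=
  mem_degGE_one.2 (freeNilpotentLie_le d N ha)

/-- The free nilpotent Lie algebra is graded. -/
theorem homPart_mem {a : TruncTensor d N} (ha : a ∈ freeNilpotentLie d N) (k : ℕ) :
    homPart k a ∈ freeNilpotentLie d N := by
  let K : LieSubalgebra ℝ (TruncTensor d N) :=
    { carrier := {a | ∀ k, homPart k a ∈ freeNilpotentLie d N}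
      add_mem' := fun ha hb k => by rw [map_add]; exact add_mem (ha k) (hb k)
      zero_mem' := fun k => by rw [map_zero]; exact zero_mem _
      smul_mem' := fun c a ha k => by
        rw [map_smul]; exact (freeNilpotentLie d N).smul_mem c (ha k)
      lie_mem' := fun {a b} ha hb k => by
        rw [homPart_lie]
        exact sum_mem fun i _ => (freeNilpotentLie d N).lie_mem (ha i) (hb _) }
  have : freeNilpotentLie d N ≤ K := freeNilpotentLie_le_of_letter fun i k => by
    rw [homPart_letter]
    split_ifs
    · exact letter_mem_freeNilpotentLie i
    · exact zero_mem _
  exact this ha k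

theorem mem_of_forall_homPart_mem {a : TruncTensor d N}
    (h : ∀ k, homPart k a ∈ freeNilpotentLie d N) : a ∈ freeNilpotentLie d N := by
  rw [← sum_homPart a]; exact sum_mem fun k _ => h k

theorem euler_mem {a : TruncTensor d N} (ha : a ∈ freeNilpotentLie d N) :
    euler a ∈ freeNilpotentLie d N :=
  mem_of_forall_homPart_mem fun k => by
    rw [homPart_euler]; exact (freeNilpotentLie d N).smul_mem _ (homPart_mem ha k)

end

/-! ### Differential equations in the Lie algebra and the logarithmic derivative -/

section

open TruncTensor

variable {d N : ℕ}

namespace TruncTensor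

theorem hasDerivAt_iff {f : ℝ → TruncTensor d N} {f' : TruncTensor d N} {x : ℝ} :
    HasDerivAt f f' x ↔ ∀ w, HasDerivAt (fun t => f t w) (f' w) x :=
  hasDerivAt_pi (E' := fun _ : Word d N => ℝ)

/-- The product rule, in coordinates: the norm of `T^N(ℝ^d)` is not submultiplicative, in general,
so it does not make `T^N(ℝ^d)` a normed ring. -/
theorem hasDerivAt_mul {f g : ℝ → TruncTensor d N} {f' g' : TruncTensor d N} {x : ℝ}
    (hf : HasDerivAt f f' x) (hg : HasDerivAt g g' x) :
    HasDerivAt (fun t => f t * g t) (f' * g x + f x * g') x := by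
  rw [hasDerivAt_iff] at hf hg ⊢
  intro w
  simp only [mul_apply, add_apply, ← Finset.sum_add_distrib]
  exact HasDerivAt.fun_sum fun i _ => (hf _).mul (hg _)

theorem hasDerivAt_linear (L : TruncTensor d N →ₗ[ℝ] TruncTensor d N)
    {f : ℝ → TruncTensor d N} {f' : TruncTensor d N} {x : ℝ} (hf : HasDerivAt f f' x) :
    HasDerivAt (fun t => L (f t)) (L f') x :=
  (LinearMap.toContinuousLinearMap L).hasFDerivAt.comp_hasDerivAt x hf

theorem hasDerivAt_pow_of_commute {f : ℝ → TruncTensor d N} {f' : TruncTensor d N} {x : ℝ}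
    (hf : HasDerivAt f f' x) (hc : Commute (f x) f') (n : ℕ) :
    HasDerivAt (fun t => f t ^ n) ((n : ℝ) • (f x ^ (n - 1) * f')) x := by
  induction n with
  | zero => simpa using hasDerivAt_const x (1 : TruncTensor d N)
  | succ n ih =>
    have h := hasDerivAt_mul ih hf
    simp only [← pow_succ] at h
    convert! h using 1
    rw [smul_mul_assoc, mul_assoc, ← hc.eq, ← mul_assoc]
    rcases n with _ | n
    · simp
    · simp only [Nat.add_sub_cancel]
      rw [← pow_succ]
      push_cast
      module

/-- Absolute continuity on `[0, 1]` of all coordinates of a tensor-valued function. -/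
def CoordAC (f : ℝ → TruncTensor d N) : Prop :=
  ∀ w, AbsolutelyContinuousOnInterval (fun t => f t w) 0 1

theorem absolutelyContinuous_const {X : Type*} [PseudoMetricSpace X] (c : X) (a b : ℝ) :
    AbsolutelyContinuousOnInterval (fun _ => c) a b :=
  (LipschitzWith.const c).lipschitzOnWith.absolutelyContinuousOnInterval (K := 0)

theorem absolutelyContinuous_sum {ι : Type*} (s : Finset ι) {f : ι → ℝ → ℝ} {a b : ℝ}
    (h : ∀ i ∈ s, AbsolutelyContinuousOnInterval (f i) a b) :
    AbsolutelyContinuousOnInterval (fun t => ∑ i ∈ s, f i t) a b := by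
  classical
  induction s using Finset.induction_on with
  | empty => simpa using absolutelyContinuous_const (0 : ℝ) a b
  | insert i s hi ih =>
    simp only [Finset.sum_insert hi]
    exact (h i (Finset.mem_insert_self i s)).fun_add
      (ih fun j hj => h j (Finset.mem_insert_of_mem hj))

theorem CoordAC.const (a : TruncTensor d N) : CoordAC fun _ => a :=
  fun w => absolutelyContinuous_const (a w) 0 1

theorem CoordAC.mul {f g : ℝ → TruncTensor d N} (hf : CoordAC f) (hg : CoordAC g) :
    CoordAC fun t => f t * g t := fun w => by
  simp only [mul_apply]
  exact absolutelyContinuous_sum _ fun i _ => (hf _).fun_mul (hg _)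

theorem CoordAC.sub {f g : ℝ → TruncTensor d N} (hf : CoordAC f) (hg : CoordAC g) :
    CoordAC fun t => f t - g t := fun w => (hf w).fun_sub (hg w)

theorem CoordAC.pow {f : ℝ → TruncTensor d N} (hf : CoordAC f) (n : ℕ) :
    CoordAC fun t => f t ^ n := by
  induction n with
  | zero => simpa using CoordAC.const 1
  | succ n ih => simpa only [pow_succ] using ih.mul hf

theorem CoordAC.sum {ι : Type*} {s : Finset ι} {f : ι → ℝ → TruncTensor d N}
    (h : ∀ i ∈ s, CoordAC (f i)) : CoordAC fun t => ∑ i ∈ s, f i t := fun w => by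
  simp only [sum_apply]
  exact absolutelyContinuous_sum _ fun i hi => h i hi w

theorem CoordAC.euler {f : ℝ → TruncTensor d N} (hf : CoordAC f) :
    CoordAC fun t => euler (f t) := fun w => (hf w).const_mul _

theorem CoordAC.linear {f : ℝ → TruncTensor d N} (hf : CoordAC f)
    (L : TruncTensor d N →ₗ[ℝ] ℝ) : AbsolutelyContinuousOnInterval (fun t => L (f t)) 0 1 := by
  classical
  let L' : (Word d N → ℝ) →ₗ[ℝ] ℝ := L
  have : ∀ a : TruncTensor d N, L a = ∑ w, a w * L' (Pi.single w 1) := fun a =>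
    LinearMap.pi_apply_eq_sum_univ L' a |>.trans (by
      refine Finset.sum_congr rfl fun w _ => ?_
      rw [smul_eq_mul]
      congr 2
      ext v
      simp [Pi.single_apply, eq_comm])
  simp only [this]
  exact absolutelyContinuous_sum _ fun w _ => (hf w).fun_mul (absolutelyContinuous_const _ 0 1)

end TruncTensor

/-- A function with `f' = p + [f, z]` almost everywhere, where `p` and `z` take values in the
graded Lie algebra `𝔤^N`, stays in `𝔤^N`: the component of degree `k` of `[f, z]` only involves
the components of `f` of degree less than `k`. -/
theorem mem_freeNilpotentLie_of_hasDerivAt {f : ℝ → TruncTensor d N} (hf : CoordAC f)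
    (h0 : f 0 ∈ freeNilpotentLie d N)
    (h : ∀ᵐ s, s ∈ Set.uIcc (0 : ℝ) 1 → ∃ p ∈ freeNilpotentLie d N,
      ∃ z ∈ freeNilpotentLie d N, HasDerivAt f (p + ⁅f s, z⁆) s)
    {s : ℝ} (hs : s ∈ Set.uIcc (0 : ℝ) 1) : f s ∈ freeNilpotentLie d N := by
  refine mem_of_forall_homPart_mem fun k => ?_
  induction k using Nat.strong_induction_on generalizing s with
  | _ k ih =>
  by_contra hns
  -- a linear form which vanishes on `𝔤^N`, but not on the component of degree `k`
  obtain ⟨φ, hφ, hker⟩ := Submodule.exists_le_ker_of_notMem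
    (p := (freeNilpotentLie d N).toSubmodule) hns
  have hac := hf.linear (φ ∘ₗ homPart k)
  obtain ⟨C, hC⟩ := hac.const_of_ae_hasDerivAt_zero (by
    filter_upwards [h] with r hr hr'
    obtain ⟨p, hp, z, hz, hd⟩ := hr hr'
    have hd' := (LinearMap.toContinuousLinearMap (φ ∘ₗ homPart k)).hasFDerivAt.comp_hasDerivAt
      r hd
    have hmem : homPart k (p + ⁅f r, z⁆) ∈ freeNilpotentLie d N := by
      rw [map_add, homPart_lie]
      refine add_mem (homPart_mem hp k) (sum_mem fun i hi => ?_)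
      rw [Finset.mem_range] at hi
      rcases Nat.lt_or_ge i k with hik | hik
      · exact (freeNilpotentLie d N).lie_mem (ih i hik hr') (homPart_mem hz _)
      · rw [show k - i = 0 by omega, homPart_eq_zero (mem_degGE_one_of_mem hz) Nat.zero_lt_one,
          lie_zero]
        exact zero_mem _
    have hz : φ (homPart k (p + ⁅f r, z⁆)) = 0 := hker hmem
    have : (LinearMap.toContinuousLinearMap (φ ∘ₗ homPart k)) (p + ⁅f r, z⁆) = 0 := hz
    rwa [this] at hd')
  have h1 : φ (homPart k (f s)) = φ (homPart k (f 0)) := (hC s hs).trans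
    (hC 0 Set.left_mem_uIcc).symm
  have h2 : φ (homPart k (f 0)) = 0 := hker (homPart_mem h0 k)
  exact hφ (h1.trans h2)

namespace UnitTensor

theorem mul_val (g h : UnitTensor d N) : (g * h).1 = g.1 * h.1 := rfl

theorem one_val : (1 : UnitTensor d N).1 = 1 := rfl

theorem inv_val (g : UnitTensor d N) :
    (g⁻¹).1 = ∑ k ∈ Finset.range (N + 1), (1 - g.1) ^ k := rfl

theorem inv_mul_val (g : UnitTensor d N) : (g⁻¹).1 * g.1 = 1 := by
  rw [← mul_val, inv_mul_cancel, one_val]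

theorem mul_inv_val (g : UnitTensor d N) : g.1 * (g⁻¹).1 = 1 := by
  rw [← mul_val, mul_inv_cancel, one_val]

theorem sub_one_mem (g : UnitTensor d N) : g.1 - 1 ∈ degGE d N 1 :=
  mem_degGE_one.2 (by rw [map_sub, g.2, scalarPart_one, sub_self])

/-- The logarithmic derivative `g⁻¹ ⊗ E g` of an element of `1 + 𝔱^N` with respect to the Euler
derivation `E`. -/
noncomputable def logEuler (g : UnitTensor d N) : TruncTensor d N := (g⁻¹).1 * euler g.1

end UnitTensor

open UnitTensor

/-- If `S' = S ⊗ v` almost everywhere with `v` in `𝔤^N`, then the logarithmic derivative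
`u = S⁻¹ ⊗ E S` satisfies `u' = E v + [u, v]`, so it stays in `𝔤^N`. -/
theorem logEuler_mem_of_hasDerivAt {S : ℝ → UnitTensor d N} (hS : CoordAC fun s => (S s).1)
    (h0 : logEuler (S 0) ∈ freeNilpotentLie d N)
    (h : ∀ᵐ s, s ∈ Set.uIcc (0 : ℝ) 1 → ∃ v ∈ freeNilpotentLie d N,
      HasDerivAt (fun r => (S r).1) ((S s).1 * v) s)
    {s : ℝ} (hs : s ∈ Set.uIcc (0 : ℝ) 1) : logEuler (S s) ∈ freeNilpotentLie d N := by
  have hinv : CoordAC fun s => ((S s)⁻¹).1 := by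
    simp only [inv_val]
    exact CoordAC.sum fun k _ => ((CoordAC.const 1).sub hS).pow k
  refine mem_freeNilpotentLie_of_hasDerivAt (hinv.mul hS.euler) h0 ?_ hs
  filter_upwards [h] with r hr hr'
  obtain ⟨v, hv, hd⟩ := hr hr'
  refine ⟨euler v, euler_mem hv, v, hv, ?_⟩
  -- the inverse is differentiable, being a polynomial in `S`
  obtain ⟨q, hq⟩ : ∃ q, HasDerivAt (fun s => ((S s)⁻¹).1) q r := by
    have hc : ContDiff ℝ ∞ fun a : TruncTensor d N => ∑ k ∈ Finset.range (N + 1), (1 - a) ^ k :=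
      ContDiff.sum fun k _ => (contDiff_pow_aux k).comp (contDiff_const.sub contDiff_id)
    exact ⟨_, ((hc.differentiable (by simp)).differentiableAt.hasFDerivAt).comp_hasDerivAt r hd⟩
  have hq' : q = -(v * ((S r)⁻¹).1) := by
    have h1 := hasDerivAt_mul hq hd
    have h2 : HasDerivAt (fun s => ((S s)⁻¹).1 * (S s).1) 0 r := by
      simp only [inv_mul_val]; exact hasDerivAt_const r _
    have h3 := h1.unique h2
    rw [← mul_assoc, inv_mul_val, one_mul] at h3
    calc q = q * (S r).1 * ((S r)⁻¹).1 := by rw [mul_assoc, mul_inv_val, mul_one]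
      _ = _ := by rw [eq_neg_of_add_eq_zero_left h3, neg_mul]
  convert! hasDerivAt_mul hq (hasDerivAt_linear euler hd) using 1
  have e : ((S r)⁻¹).1 * ((S r).1 * euler v) = euler v := by
    rw [← mul_assoc, inv_mul_val, one_mul]
  rw [hq', euler_mul, bracket_def, mul_add, e]
  noncomm_ring

end

/-! ### Exponential and logarithm -/

section

open TruncTensor UnitTensor

variable {d N : ℕ}

namespace TruncTensor

theorem texp_eq_sum (a : TruncTensor d N) :
    texp a = ∑ k ∈ Finset.range (N + 1), ((k.factorial : ℝ)⁻¹) • a ^ k := by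
  rw [texp, Finset.range_eq_Ico, Finset.sum_eq_sum_Ico_succ_bot (by omega), zero_add,
    Finset.Ico_add_one_right_eq_Icc]
  simp

theorem scalarPart_texp {a : TruncTensor d N} (ha : a ∈ degGE d N 1) :
    scalarPart (texp a) = 1 := by
  rw [texp, map_add, scalarPart_one, map_sum, Finset.sum_eq_zero, add_zero]
  intro k hk
  have h1 : a ^ k ∈ degGE d N 1 := degGE_anti (Finset.mem_Icc.1 hk).1 (pow_mem_degGE ha k)
  rw [map_smul, mem_degGE_one.1 h1, smul_zero]

theorem texp_zero : texp (0 : TruncTensor d N) = 1 := by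
  rw [texp, Finset.sum_eq_zero, add_zero]
  intro k hk
  rw [zero_pow (by have := (Finset.mem_Icc.1 hk).1; omega), smul_zero]

/-- The exponential changes to first order by the increment: if `s` has components of degree at
least `k` only, then so has `exp (z + s) - exp z`, and its component of degree `k` is that
of `s`. -/
theorem texp_add_sub_mem {k : ℕ} {z s : TruncTensor d N} (hz : z ∈ degGE d N 1)
    (hk : 1 ≤ k) (hs : s ∈ degGE d N k) :
    texp (z + s) - texp z - s ∈ degGE d N (k + 1) := by
  have hpow : ∀ n, (z + s) ^ (n + 1) - z ^ (n + 1) ∈ degGE d N (k + n) := by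
    intro n
    induction n with
    | zero => simpa using hs
    | succ n ih =>
      have : (z + s) ^ (n + 1 + 1) - z ^ (n + 1 + 1) =
          (z + s) * ((z + s) ^ (n + 1) - z ^ (n + 1)) + s * z ^ (n + 1) := by
        rw [pow_succ' (z + s), pow_succ' z]; noncomm_ring
      rw [this]
      refine add_mem ?_ ?_
      · have h := mul_mem_degGE (add_mem hz (degGE_anti hk hs)) ih
        exact degGE_anti (by omega) h
      · exact mul_mem_degGE hs (pow_mem_degGE hz _)
  rcases Nat.eq_zero_or_pos N with rfl | hN
  · have : ∀ a ∈ degGE d 0 (k + 0), a = 0 := fun a ha => eq_zero_of_mem_degGE (by omega) ha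
    rw [this s hs]
    simp
  obtain ⟨M, rfl⟩ : ∃ M, N = M + 1 := ⟨N - 1, by omega⟩
  have : texp (z + s) - texp z - s = ∑ j ∈ Finset.range M,
      (((j + 2).factorial : ℝ)⁻¹) • ((z + s) ^ (j + 2) - z ^ (j + 2)) := by
    rw [texp_eq_sum, texp_eq_sum, ← Finset.sum_sub_distrib]
    simp only [← smul_sub]
    rw [Finset.sum_range_succ', Finset.sum_range_succ']
    simp
  rw [this]
  exact sum_mem fun j _ => Submodule.smul_mem _ _ (degGE_anti (by omega) (hpow (j + 1)))

theorem texp_sub_mem {a : TruncTensor d N} {k : ℕ} (hk : 1 ≤ k) (ha : a ∈ degGE d N k) :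
    texp a - 1 - a ∈ degGE d N (k + 1) := by
  have := texp_add_sub_mem (zero_mem (degGE d N 1)) hk ha
  rwa [zero_add, texp_zero] at this

/-- The derivative of `exp (f t)` where `f` and `f'` commute. -/
theorem hasDerivAt_texp_of_commute {f : ℝ → TruncTensor d N} {f' : TruncTensor d N} {x : ℝ}
    (hf : HasDerivAt f f' x) (hc : Commute (f x) f') (hx : f x ∈ degGE d N 1)
    (hx' : f' ∈ degGE d N 1) :
    HasDerivAt (fun t => texp (f t)) (texp (f x) * f') x := by
  simp only [texp_eq_sum]
  have h := HasDerivAt.fun_sum (u := Finset.range (N + 1)) fun k _ =>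
    (hasDerivAt_pow_of_commute hf hc k).const_smul ((k.factorial : ℝ)⁻¹)
  convert! h using 1
  have h0 : f x ^ N * f' = 0 := eq_zero_of_mem_degGE (Nat.lt_succ_self N)
    (mul_mem_degGE (pow_mem_degGE hx N) hx')
  rw [Finset.sum_range_succ, Finset.sum_range_succ' (n := N), add_mul, smul_mul_assoc, h0,
    smul_zero, add_zero, Finset.sum_mul]
  simp only [Nat.cast_zero, zero_smul, smul_zero, add_zero]
  refine Finset.sum_congr rfl fun k _ => ?_
  rw [Nat.add_sub_cancel, smul_mul_assoc, smul_smul, Nat.factorial_succ]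
  congr 1
  push_cast
  field_simp

theorem hasDerivAt_texp_smul {a : TruncTensor d N} (ha : a ∈ degGE d N 1) (x : ℝ) :
    HasDerivAt (fun t : ℝ => texp (t • a)) (texp (x • a) * a) x := by
  have h : HasDerivAt (fun t : ℝ => t • a) a x := by
    simpa using (hasDerivAt_id x).smul_const a
  exact hasDerivAt_texp_of_commute h ((Commute.refl a).smul_left x)
    (Submodule.smul_mem _ _ ha) ha

theorem commute_texp {a b : TruncTensor d N} (h : Commute a b) : Commute (texp a) b := by
  rw [texp_eq_sum]
  exact Commute.sum_left _ _ _ fun k _ => (h.pow_left k).smul_left _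

theorem eq_of_hasDerivAt_zero {f : ℝ → TruncTensor d N} (h : ∀ x, HasDerivAt f 0 x) (x y : ℝ) :
    f x = f y :=
  is_const_of_deriv_eq_zero (fun x => (h x).differentiableAt) (fun x => (h x).deriv) x y

theorem texp_neg_mul_texp {a : TruncTensor d N} (ha : a ∈ degGE d N 1) :
    texp (-a) * texp a = 1 := by
  have h : ∀ x : ℝ, HasDerivAt (fun t : ℝ => texp (t • -a) * texp (t • a)) 0 x := by
    intro x
    convert! hasDerivAt_mul (hasDerivAt_texp_smul (neg_mem ha) x) (hasDerivAt_texp_smul ha x)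
      using 1
    have hc : Commute (texp (x • a)) a := commute_texp ((Commute.refl a).smul_left x)
    rw [hc.eq]
    noncomm_ring
  have := eq_of_hasDerivAt_zero h 1 0
  simpa [texp_zero] using this

theorem texp_add_of_commute {a b : TruncTensor d N} (hab : Commute a b) (ha : a ∈ degGE d N 1)
    (hb : b ∈ degGE d N 1) : texp (a + b) = texp a * texp b := by
  have h : ∀ x : ℝ, HasDerivAt (fun t : ℝ => texp (t • (a + b)) * texp (t • -b) *
      texp (t • -a)) 0 x := by
    intro x
    convert! hasDerivAt_mul (hasDerivAt_mul (hasDerivAt_texp_smul (add_mem ha hb) x)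
      (hasDerivAt_texp_smul (neg_mem hb) x)) (hasDerivAt_texp_smul (neg_mem ha) x) using 1
    have h1 : Commute (texp (x • -b)) b :=
      commute_texp (((Commute.refl b).neg_left).smul_left x)
    have h2 : Commute (texp (x • -b)) a := commute_texp ((hab.symm.neg_left).smul_left x)
    have h3 : Commute (texp (x • -a)) a :=
      commute_texp (((Commute.refl a).neg_left).smul_left x)
    have e1 : texp (x • (a + b)) * (a + b) * texp (x • -b) =
        texp (x • (a + b)) * texp (x • -b) * (a + b) := by
      rw [mul_assoc, ((h2.add_right h1).eq.symm), mul_assoc]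
    rw [e1, h3.neg_right.eq]
    noncomm_ring
  have h4 := eq_of_hasDerivAt_zero h 1 0
  simp only [one_smul, zero_smul, texp_zero, mul_one] at h4
  calc texp (a + b) = texp (a + b) * texp (-b) * texp (-a) * (texp a * texp b) := by
        have e1 : texp (-a) * (texp a * texp b) = texp b := by
          rw [← mul_assoc, texp_neg_mul_texp ha, one_mul]
        rw [mul_assoc, e1, mul_assoc, texp_neg_mul_texp hb, mul_one]
    _ = _ := by rw [h4, one_mul]

/-- The logarithm `log (1 + x) = ∑_{k = 1}^N (-1)^{k + 1} x^{⊗ k} / k`, as a function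
of `x`. -/
noncomputable def tlog (x : TruncTensor d N) : TruncTensor d N :=
  ∑ k ∈ Finset.range N, ((-1 : ℝ) ^ k / (k + 1)) • x ^ (k + 1)

theorem tlog_mem {x : TruncTensor d N} (hx : x ∈ degGE d N 1) : tlog x ∈ degGE d N 1 :=
  sum_mem fun k _ => Submodule.smul_mem _ _ (degGE_anti (by omega) (pow_mem_degGE hx (k + 1)))

theorem commute_tlog {x y : TruncTensor d N} (h : Commute x y) : Commute (tlog x) y :=
  Commute.sum_left _ _ _ fun k _ => (h.pow_left (k + 1)).smul_left _

/-- The derivative in `s` of `exp (-log (1 + s x)) ⊗ (1 + s x)` vanishes. -/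
theorem texp_tlog {x : TruncTensor d N} (hx : x ∈ degGE d N 1) : texp (tlog x) = 1 + x := by
  -- the derivative of `s ↦ log (1 + s x)`
  let l' : ℝ → TruncTensor d N := fun s => ∑ k ∈ Finset.range N, (-s • x) ^ k * x
  have hxs : ∀ s : ℝ, s • x ∈ degGE d N 1 := fun s => Submodule.smul_mem _ _ hx
  have hl : ∀ s : ℝ, HasDerivAt (fun s : ℝ => tlog (s • x)) (l' s) s := by
    intro s
    have hsm : HasDerivAt (fun t : ℝ => t • x) x s := by
      simpa using (hasDerivAt_id s).smul_const x
    have h := HasDerivAt.fun_sum (u := Finset.range N) fun k _ =>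
      (hasDerivAt_pow_of_commute hsm ((Commute.refl x).smul_left s) (k + 1)).const_smul
        ((-1 : ℝ) ^ k / (k + 1))
    convert! h using 1
    refine Finset.sum_congr rfl fun k _ => ?_
    rw [Nat.add_sub_cancel, smul_smul, ← smul_mul_assoc]
    congr 1
    have hk : ((k : ℝ) + 1) ≠ 0 := by positivity
    rw [smul_pow, smul_pow, smul_smul, neg_pow]
    congr 1
    push_cast
    field_simp
  have hl'1 : ∀ s, l' s ∈ degGE d N 1 := fun s =>
    sum_mem fun k _ => mul_mem_degGE_right _ hx
  have hgeom : ∀ s, l' s * (1 + s • x) = x := by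
    intro s
    have hc : Commute x (1 + s • x) :=
      (Commute.one_right x).add_right ((Commute.refl x).smul_right s)
    have h1 := geom_sum_mul_neg (-s • x) N
    have h2 : l' s = (∑ k ∈ Finset.range N, (-s • x) ^ k) * x := (Finset.sum_mul _ _ _).symm
    have h3 : (1 : TruncTensor d N) - -s • x = 1 + s • x := by rw [neg_smul, sub_neg_eq_add]
    rw [h3] at h1
    have h4 : (-s • x) ^ N * x = 0 := eq_zero_of_mem_degGE (Nat.lt_succ_self N)
      (mul_mem_degGE (pow_mem_degGE (hxs (-s)) N) hx)
    rw [h2, mul_assoc, hc.eq, ← mul_assoc, h1, sub_mul, h4, one_mul, sub_zero]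
  have h : ∀ s : ℝ, HasDerivAt (fun s : ℝ => texp (-tlog (s • x)) * (1 + s • x)) 0 s := by
    intro s
    have hsm : HasDerivAt (fun t : ℝ => 1 + t • x) x s := by
      simpa using ((hasDerivAt_id s).smul_const x).const_add 1
    have hcl : Commute (-tlog (s • x)) (-l' s) := by
      refine (Commute.neg_left (Commute.neg_right (commute_tlog (Commute.sum_right _ _ _ ?_))))
      intro k _
      exact ((((Commute.refl x).smul_right _).pow_right k).mul_right (Commute.refl x)).smul_left s
    convert! hasDerivAt_mul (hasDerivAt_texp_of_commute (hl s).fun_neg hcl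
      (neg_mem (tlog_mem (hxs s))) (neg_mem (hl'1 s))) hsm using 1
    rw [mul_neg, neg_mul, mul_assoc, hgeom, neg_add_cancel]
  have h1 := eq_of_hasDerivAt_zero h 1 0
  have h0 : tlog (0 : TruncTensor d N) = 0 := Finset.sum_eq_zero fun k _ => by
    rw [zero_pow (Nat.succ_ne_zero k), smul_zero]
  simp only [one_smul, zero_smul, h0, neg_zero, texp_zero, add_zero, mul_one] at h1
  have h2 := texp_neg_mul_texp (neg_mem (tlog_mem hx))
  rw [neg_neg] at h2
  calc texp (tlog x) = texp (tlog x) * (texp (-tlog x) * (1 + x)) := by rw [h1, mul_one]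
    _ = _ := by rw [← mul_assoc, h2, one_mul]

/-- The only solution of `exp c = 1` is `c = 0`: otherwise the lowest components of `c` and
`exp c - 1` agree. -/
theorem eq_zero_of_texp_eq_one {c : TruncTensor d N} (hc : c ∈ degGE d N 1)
    (h : texp c = 1) : c = 0 := by
  have : ∀ k, c ∈ degGE d N (k + 1) := by
    intro k
    induction k with
    | zero => exact hc
    | succ k ih =>
      have h1 := texp_sub_mem (by omega) ih
      rw [h, sub_self, zero_sub] at h1
      simpa using neg_mem h1
  exact eq_zero_of_mem_degGE (by omega) (this N)

theorem tlog_texp {a : TruncTensor d N} (ha : a ∈ degGE d N 1) : tlog (texp a - 1) = a := by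
  have h1 : texp a - 1 ∈ degGE d N 1 :=
    mem_degGE_one.2 (by rw [map_sub, scalarPart_texp ha, scalarPart_one, sub_self])
  have h2 := texp_tlog h1
  rw [add_sub_cancel] at h2
  have hc : Commute (tlog (texp a - 1)) (-a) := (commute_tlog
    ((commute_texp (Commute.refl a)).sub_left (Commute.one_left a))).neg_right
  have h3 := texp_add_of_commute hc (tlog_mem h1) (neg_mem ha)
  have h4 := texp_neg_mul_texp (neg_mem ha)
  rw [neg_neg] at h4
  rw [h2, h4] at h3
  exact add_neg_eq_zero.1 (eq_zero_of_texp_eq_one (add_mem (tlog_mem h1) (neg_mem ha)) h3)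

theorem contDiff_texp : ContDiff ℝ ∞ (texp : TruncTensor d N → TruncTensor d N) := by
  have : (texp : TruncTensor d N → TruncTensor d N) = fun a =>
      ∑ k ∈ Finset.range (N + 1), ((k.factorial : ℝ)⁻¹) • a ^ k := funext texp_eq_sum
  rw [this]
  exact ContDiff.sum fun k _ => (contDiff_pow_aux k).const_smul _

theorem contDiff_tlog : ContDiff ℝ ∞ (tlog : TruncTensor d N → TruncTensor d N) :=
  ContDiff.sum fun k _ => (contDiff_pow_aux (k + 1)).const_smul _

end TruncTensor

end

/-! ### Elements of the group with logarithmic derivative in the Lie algebra -/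

section

open TruncTensor UnitTensor

variable {d N : ℕ}

/-- The exponential of a tensor without component of degree zero, as an element of the group
`1 + 𝔱^N`. -/
noncomputable def uexp (a : TruncTensor d N) (ha : a ∈ degGE d N 1) : UnitTensor d N :=
  ⟨texp a, scalarPart_texp ha⟩

theorem uexp_val (a : TruncTensor d N) (ha : a ∈ degGE d N 1) : (uexp a ha).1 = texp a := rfl

theorem uexp_inv (a : TruncTensor d N) (ha : a ∈ degGE d N 1) :
    (uexp a ha)⁻¹ = uexp (-a) (neg_mem ha) :=
  inv_eq_of_mul_eq_one_left (Subtype.ext (texp_neg_mul_texp ha))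

theorem logEuler_one : logEuler (1 : UnitTensor d N) = 0 := by
  rw [logEuler, one_val, euler_one, mul_zero]

/-- The elements with logarithmic derivative in `𝔤^N` are stable under right multiplication by
`exp 𝔤^N`, by the differential equation along `s ↦ S ⊗ exp (s z)`. -/
theorem logEuler_mul_uexp_mem {S : UnitTensor d N} (hS : logEuler S ∈ freeNilpotentLie d N)
    {z : TruncTensor d N} (hz : z ∈ freeNilpotentLie d N) :
    logEuler (S * uexp z (mem_degGE_one_of_mem hz)) ∈ freeNilpotentLie d N := by
  have hz1 := mem_degGE_one_of_mem hz
  let γ : ℝ → UnitTensor d N := fun s => S * uexp (s • z) (Submodule.smul_mem _ s hz1)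
  have hγ : ∀ s, (γ s).1 = S.1 * texp (s • z) := fun _ => rfl
  have hsz : CoordAC fun s : ℝ => s • z := fun w =>
    ContDiffOn.absolutelyContinuousOnInterval
      (f := fun s : ℝ => s * z w) (contDiff_id.mul contDiff_const).contDiffOn
  have hac : CoordAC fun s => (γ s).1 := by
    simp only [hγ, texp_eq_sum]
    refine (CoordAC.const S.1).mul (CoordAC.sum fun k _ => fun w => ?_)
    exact ((hsz.pow k) w).const_mul ((k.factorial : ℝ)⁻¹)
  have h0 : γ 0 = S := Subtype.ext (by rw [hγ, zero_smul, texp_zero, mul_one])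
  have h1 : γ 1 = S * uexp z hz1 := Subtype.ext (by rw [hγ, one_smul]; rfl)
  rw [← h1]
  refine logEuler_mem_of_hasDerivAt hac (h0 ▸ hS) (Filter.Eventually.of_forall fun s _ => ?_)
    Set.right_mem_uIcc
  refine ⟨z, hz, ?_⟩
  simp only [hγ]
  convert! hasDerivAt_mul (hasDerivAt_const s S.1) (hasDerivAt_texp_smul hz1 s) using 1
  rw [zero_mul, zero_add, mul_assoc]

theorem logEuler_uexp_mem {z : TruncTensor d N} (hz : z ∈ freeNilpotentLie d N) :
    logEuler (uexp z (mem_degGE_one_of_mem hz)) ∈ freeNilpotentLie d N := by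
  have := logEuler_mul_uexp_mem (S := 1) (by rw [logEuler_one]; exact zero_mem _) hz
  rwa [one_mul] at this

/-- The lowest component of `S - 1` lies in `𝔤^N` if the logarithmic derivative of `S` does. -/
theorem homPart_mem_of_logEuler_mem {S : UnitTensor d N}
    (hS : logEuler S ∈ freeNilpotentLie d N) {k : ℕ} (hk : 1 ≤ k)
    (hSk : S.1 - 1 ∈ degGE d N k) : homPart k (S.1 - 1) ∈ freeNilpotentLie d N := by
  have he : euler S.1 = euler (S.1 - 1) := by rw [map_sub, euler_one, sub_zero]
  have h1 : logEuler S - euler (S.1 - 1) ∈ degGE d N (k + 1) := by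
    have : logEuler S - euler (S.1 - 1) = ((S⁻¹).1 - 1) * euler (S.1 - 1) := by
      rw [logEuler, he, sub_mul, one_mul]
    rw [this, add_comm]
    exact mul_mem_degGE (sub_one_mem S⁻¹) (euler_mem_degGE hSk)
  have h2 := homPart_eq_zero h1 (Nat.lt_succ_self k)
  rw [map_sub, sub_eq_zero, homPart_euler] at h2
  have h3 := homPart_mem hS k
  rw [h2] at h3
  have hk0 : (k : ℝ) ≠ 0 := by positivity
  have := (freeNilpotentLie d N).smul_mem ((k : ℝ)⁻¹) h3
  rwa [inv_smul_smul₀ hk0] at this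

/-- Every element with logarithmic derivative in `𝔤^N` is the exponential of an element of
`𝔤^N`, which is found degree by degree. -/
theorem exists_texp_eq_of_logEuler_mem {S : UnitTensor d N}
    (hS : logEuler S ∈ freeNilpotentLie d N) : ∃ z ∈ freeNilpotentLie d N, texp z = S.1 := by
  have key : ∀ k, ∃ z ∈ freeNilpotentLie d N, S.1 - texp z ∈ degGE d N (k + 1) := by
    intro k
    induction k with
    | zero => exact ⟨0, zero_mem _, by rw [texp_zero]; exact sub_one_mem S⟩
    | succ k ih =>
      obtain ⟨z, hz, hk⟩ := ih
      have hz1 := mem_degGE_one_of_mem hz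
      have hR := logEuler_mul_uexp_mem hS (neg_mem hz)
      set R := S * uexp (-z) (mem_degGE_one_of_mem (neg_mem hz)) with hRdef
      have hRv : R.1 = S.1 * texp (-z) := rfl
      have hinv : texp z * texp (-z) = 1 := by
        have := texp_neg_mul_texp (neg_mem hz1); rwa [neg_neg] at this
      have hR1 : R.1 - 1 = (S.1 - texp z) * texp (-z) := by rw [sub_mul, hinv, hRv]
      have hR2 : R.1 - 1 ∈ degGE d N (k + 1) := by
        rw [hR1]; exact mul_mem_degGE_left hk _
      have hs := homPart_mem_of_logEuler_mem hR (by omega) hR2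
      set s := homPart (k + 1) (R.1 - 1) with hsdef
      refine ⟨z + s, add_mem hz hs, ?_⟩
      have hSz : S.1 - texp z = (R.1 - 1) * texp z := by
        rw [hR1, mul_assoc, texp_neg_mul_texp hz1, mul_one]
      have e : S.1 - texp (z + s) = (R.1 - 1 - s) + (R.1 - 1) * (texp z - 1) -
          (texp (z + s) - texp z - s) := by
        rw [mul_sub, ← hSz]; noncomm_ring
      rw [e]
      refine sub_mem (add_mem (sub_homPart_mem_degGE hR2) ?_)
        (texp_add_sub_mem hz1 (by omega) (homPart_mem_degGE _ _))
      exact mul_mem_degGE hR2 (sub_one_mem (uexp z hz1))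
  obtain ⟨z, hz, h⟩ := key N
  exact ⟨z, hz, (sub_eq_zero.1 (eq_zero_of_mem_degGE (by omega) h)).symm⟩

theorem smul_letter_mem (c : ℝ) (i : Fin d) :
    c • (letter i : TruncTensor d N) ∈ freeNilpotentLie d N :=
  (freeNilpotentLie d N).smul_mem c (letter_mem_freeNilpotentLie i)

/-- The subgroup of `1 + 𝔱^N` generated by the signatures `exp (c e_i)` of the segments in the
coordinate directions. -/
noncomputable def segmentGroup (d N : ℕ) : Subgroup (UnitTensor d N) :=
  Subgroup.closure {g | ∃ (c : ℝ) (i : Fin d), g.1 = texp (c • letter i)}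

/-- The tensors `w` of degree at least `k` such that every multiple `c w` is the leading part of
`h - 1` for some `h` in the group generated by the segments. -/
def leadingParts (d N k : ℕ) : Set (TruncTensor d N) :=
  {w | w ∈ degGE d N k ∧ ∀ c : ℝ, ∃ h ∈ segmentGroup d N, h.1 - 1 - c • w ∈ degGE d N (k + 1)}

theorem leadingParts_zero (k : ℕ) : (0 : TruncTensor d N) ∈ leadingParts d N k :=
  ⟨zero_mem _, fun c => ⟨1, one_mem _, by
    rw [one_val, sub_self, smul_zero, sub_zero]; exact zero_mem _⟩⟩

theorem leadingParts_smul {k : ℕ} {w : TruncTensor d N} (hw : w ∈ leadingParts d N k) (c : ℝ) :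
    c • w ∈ leadingParts d N k :=
  ⟨Submodule.smul_mem _ _ hw.1, fun c' => by rw [smul_smul]; exact hw.2 (c' * c)⟩

theorem sub_one_mem_of_leading {k : ℕ} {h : UnitTensor d N} {w : TruncTensor d N}
    (hw : w ∈ degGE d N k) (hh : h.1 - 1 - w ∈ degGE d N (k + 1)) : h.1 - 1 ∈ degGE d N k := by
  have := add_mem (degGE_anti (Nat.le_succ k) hh) hw
  rwa [sub_add_cancel] at this

theorem leadingParts_add {k : ℕ} (hk : 1 ≤ k) {w w' : TruncTensor d N}
    (hw : w ∈ leadingParts d N k) (hw' : w' ∈ leadingParts d N k) :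
    w + w' ∈ leadingParts d N k := by
  refine ⟨add_mem hw.1 hw'.1, fun c => ?_⟩
  obtain ⟨h, hh, hl⟩ := hw.2 c
  obtain ⟨h', hh', hl'⟩ := hw'.2 c
  refine ⟨h * h', mul_mem hh hh', ?_⟩
  have e : (h * h').1 - 1 - c • (w + w') = (h.1 - 1 - c • w) + (h'.1 - 1 - c • w') +
      (h.1 - 1) * (h'.1 - 1) := by
    rw [mul_val, smul_add]; noncomm_ring
  rw [e]
  refine add_mem (add_mem hl hl') (degGE_anti (by omega) (mul_mem_degGE
    (sub_one_mem_of_leading (Submodule.smul_mem _ c hw.1) hl)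
    (sub_one_mem_of_leading (Submodule.smul_mem _ c hw'.1) hl')))

/-- The leading part of a group commutator is the Lie bracket of the leading parts. -/
theorem leadingParts_lie {k l : ℕ} {w w' : TruncTensor d N}
    (hw : w ∈ leadingParts d N k) (hw' : w' ∈ leadingParts d N l) :
    ⁅w, w'⁆ ∈ leadingParts d N (k + l) := by
  have hmem : ⁅w, w'⁆ ∈ degGE d N (k + l) := by
    rw [bracket_def]
    exact sub_mem (mul_mem_degGE hw.1 hw'.1) (by rw [add_comm]; exact mul_mem_degGE hw'.1 hw.1)
  refine ⟨hmem, fun c => ?_⟩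
  obtain ⟨h, hh, hhl⟩ := hw.2 c
  obtain ⟨h', hh', hhl'⟩ := hw'.2 1
  rw [one_smul] at hhl'
  have hcw : c • w ∈ degGE d N k := Submodule.smul_mem _ c hw.1
  have hb := sub_one_mem_of_leading hw'.1 hhl'
  refine ⟨h * h' * (h' * h)⁻¹, mul_mem (mul_mem hh hh') (inv_mem (mul_mem hh' hh)), ?_⟩
  have e1 : (h * h' * (h' * h)⁻¹).1 - 1 = (h.1 * h'.1 - h'.1 * h.1) * ((h' * h)⁻¹).1 := by
    rw [sub_mul, ← mul_val h', mul_inv_val, mul_val, mul_val]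
  -- the commutator of `h` and `h'` in the algebra, up to terms of higher degree
  have e2 : h.1 * h'.1 - h'.1 * h.1 - c • ⁅w, w'⁆ ∈ degGE d N (k + l + 1) := by
    have e : h.1 * h'.1 - h'.1 * h.1 - c • ⁅w, w'⁆ =
        ((h.1 - 1 - c • w) * (h'.1 - 1) + (c • w) * (h'.1 - 1 - w')) -
        ((h'.1 - 1) * (h.1 - 1 - c • w) + (h'.1 - 1 - w') * (c • w)) := by
      have : c • ⁅w, w'⁆ = (c • w) * w' - w' * (c • w) := by
        rw [bracket_def, smul_sub, smul_mul_assoc, mul_smul_comm]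
      rw [this]
      generalize c • w = v
      noncomm_ring
    rw [e]
    refine sub_mem (add_mem ?_ ?_) (add_mem ?_ ?_)
    · exact degGE_anti (by omega) (mul_mem_degGE hhl hb)
    · exact degGE_anti (by omega) (mul_mem_degGE hcw hhl')
    · exact degGE_anti (by omega) (mul_mem_degGE hb hhl)
    · exact degGE_anti (by omega) (mul_mem_degGE hhl' hcw)
  have e3 : h.1 * h'.1 - h'.1 * h.1 ∈ degGE d N (k + l) := by
    have := add_mem (degGE_anti (Nat.le_succ _) e2) (Submodule.smul_mem _ c hmem)
    rwa [sub_add_cancel] at this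
  have e4 : (h * h' * (h' * h)⁻¹).1 - 1 - c • ⁅w, w'⁆ =
      (h.1 * h'.1 - h'.1 * h.1 - c • ⁅w, w'⁆) +
        (h.1 * h'.1 - h'.1 * h.1) * (((h' * h)⁻¹).1 - 1) := by
    rw [e1, mul_sub, mul_one]; abel
  rw [e4]
  exact add_mem e2 (mul_mem_degGE e3 (sub_one_mem _))

theorem leadingParts_letter (i : Fin d) : (letter i : TruncTensor d N) ∈ leadingParts d N 1 :=
  ⟨mem_degGE_one_of_mem (letter_mem_freeNilpotentLie i), fun c =>
    ⟨uexp (c • letter i) (mem_degGE_one_of_mem (smul_letter_mem c i)),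
      Subgroup.subset_closure ⟨c, i, rfl⟩,
      texp_sub_mem le_rfl (mem_degGE_one_of_mem (smul_letter_mem c i))⟩⟩

/-- Every homogeneous element of `𝔤^N` is a leading part: iterated brackets of letters are
leading parts of iterated commutators of segments. -/
theorem homPart_mem_leadingParts {a : TruncTensor d N} (ha : a ∈ freeNilpotentLie d N) {k : ℕ}
    (hk : 1 ≤ k) : homPart k a ∈ leadingParts d N k := by
  have hsum : ∀ k, 1 ≤ k → ∀ (s : Finset ℕ) (f : ℕ → TruncTensor d N),
      (∀ i ∈ s, f i ∈ leadingParts d N k) → ∑ i ∈ s, f i ∈ leadingParts d N k := by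
    intro k hk s f
    induction s using Finset.induction_on with
    | empty => intro _; exact leadingParts_zero k
    | insert i s hi ih =>
      intro h
      rw [Finset.sum_insert hi]
      exact leadingParts_add hk (h i (Finset.mem_insert_self i s))
        (ih fun j hj => h j (Finset.mem_insert_of_mem hj))
  let K : LieSubalgebra ℝ (TruncTensor d N) :=
    { carrier := {a | a ∈ degGE d N 1 ∧ ∀ k, 1 ≤ k → homPart k a ∈ leadingParts d N k}
      add_mem' := fun ha hb => ⟨add_mem ha.1 hb.1, fun k hk => by
        rw [map_add]; exact leadingParts_add hk (ha.2 k hk) (hb.2 k hk)⟩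
      zero_mem' := ⟨zero_mem _, fun k _ => by rw [map_zero]; exact leadingParts_zero k⟩
      smul_mem' := fun c a ha => ⟨Submodule.smul_mem _ c ha.1, fun k hk => by
        rw [map_smul]; exact leadingParts_smul (ha.2 k hk) c⟩
      lie_mem' := fun {a b} ha hb => ⟨sub_mem (mul_mem_degGE_left ha.1 b)
          (mul_mem_degGE_left hb.1 a), fun k hk => by
        rw [homPart_lie]
        refine hsum k hk _ _ fun i hi => ?_
        rw [Finset.mem_range] at hi
        rcases Nat.eq_zero_or_pos i with rfl | hi0
        · rw [homPart_eq_zero ha.1 Nat.zero_lt_one, zero_lie]; exact leadingParts_zero k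
        rcases Nat.eq_zero_or_pos (k - i) with h0 | hi1
        · rw [h0, homPart_eq_zero hb.1 Nat.zero_lt_one, lie_zero]; exact leadingParts_zero k
        have := leadingParts_lie (ha.2 i hi0) (hb.2 (k - i) hi1)
        rwa [show i + (k - i) = k by omega] at this⟩ }
  have : freeNilpotentLie d N ≤ K := freeNilpotentLie_le_of_letter fun i =>
    ⟨mem_degGE_one_of_mem (letter_mem_freeNilpotentLie i), fun k _ => by
      rw [homPart_letter]
      split_ifs with h
      · rw [h]; exact leadingParts_letter i
      · exact leadingParts_zero k⟩
  exact (this ha).2 k hk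

/-- The elements with logarithmic derivative in `𝔤^N` are stable under right multiplication by
products of exponentials of letters. -/
theorem logEuler_mul_mem {S : UnitTensor d N} (hS : logEuler S ∈ freeNilpotentLie d N)
    {h : UnitTensor d N} (hh : h ∈ segmentGroup d N) :
    logEuler (S * h) ∈ freeNilpotentLie d N := by
  induction hh using Subgroup.closure_induction_right generalizing S with
  | one => rwa [mul_one]
  | mul_right x _ y hy ih =>
    obtain ⟨c, i, hc⟩ := hy
    have : y = uexp (c • letter i) (mem_degGE_one_of_mem (smul_letter_mem c i)) :=
      Subtype.ext hc
    rw [← mul_assoc, this]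
    exact logEuler_mul_uexp_mem (ih hS) (smul_letter_mem c i)
  | mul_inv_cancel x _ y hy ih =>
    obtain ⟨c, i, hc⟩ := hy
    have : y = uexp (c • letter i) (mem_degGE_one_of_mem (smul_letter_mem c i)) :=
      Subtype.ext hc
    rw [← mul_assoc, this, uexp_inv]
    exact logEuler_mul_uexp_mem (ih hS) (neg_mem (smul_letter_mem c i))

/-- Every element with logarithmic derivative in `𝔤^N` is a finite product of exponentials of
letters: its components are removed degree by degree. -/
theorem mem_segmentGroup_of_logEuler_mem {S : UnitTensor d N}
    (hS : logEuler S ∈ freeNilpotentLie d N) : S ∈ segmentGroup d N := by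
  have key : ∀ n k, n + k = N + 1 → 1 ≤ k → ∀ S : UnitTensor d N,
      logEuler S ∈ freeNilpotentLie d N → S.1 - 1 ∈ degGE d N k → S ∈ segmentGroup d N := by
    intro n
    induction n with
    | zero =>
      intro k hk _ S _ hSk
      have : S = 1 := Subtype.ext (sub_eq_zero.1 (eq_zero_of_mem_degGE (by omega) hSk))
      rw [this]; exact one_mem _
    | succ n ih =>
      intro k hnk hk S hS hSk
      have hs := homPart_mem_leadingParts (homPart_mem_of_logEuler_mem hS hk hSk) hk
      rw [homPart_homPart_self] at hs
      obtain ⟨h, hh, hl⟩ := hs.2 1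
      rw [one_smul] at hl
      have h1 : (S * h⁻¹).1 - 1 = (S.1 - h.1) * (h⁻¹).1 := by
        rw [sub_mul, mul_inv_val, mul_val]
      have h2 : S.1 - h.1 ∈ degGE d N (k + 1) := by
        have := sub_mem (sub_homPart_mem_degGE hSk) hl
        have e : S.1 - h.1 = S.1 - 1 - homPart k (S.1 - 1) -
            (h.1 - 1 - homPart k (S.1 - 1)) := by abel
        rwa [e]
      have h3 := ih (k + 1) (by omega) (by omega) (S * h⁻¹) (logEuler_mul_mem hS (inv_mem hh))
        (by rw [h1]; exact mul_mem_degGE_left h2 _)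
      simpa using mul_mem h3 hh
  exact key N 1 rfl le_rfl S hS (sub_one_mem S)

end

/-! ### Signatures of paths -/

section

open TruncTensor UnitTensor

variable {d N : ℕ}

theorem absolutelyContinuous_congr {f g : ℝ → ℝ} {a b : ℝ}
    (hf : AbsolutelyContinuousOnInterval f a b) (h : ∀ t ∈ Set.uIcc a b, f t = g t) :
    AbsolutelyContinuousOnInterval g a b := by
  rw [absolutelyContinuousOnInterval_iff] at hf ⊢
  intro ε hε
  obtain ⟨δ, hδ, hf⟩ := hf ε hε
  refine ⟨δ, hδ, fun E hE hl => ?_⟩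
  rw [Finset.sum_congr rfl fun i hi => by
    rw [← h _ (hE.1 i hi).1, ← h _ (hE.1 i hi).2]]
  exact hf E hE hl

/-- The vector of `ℝ^d` with the given coordinates, as a tensor of degree one. -/
noncomputable def vecTensor (N : ℕ) (c : Fin d → ℝ) : TruncTensor d N := ∑ i, c i • letter i

theorem vecTensor_mem (c : Fin d → ℝ) : vecTensor N c ∈ freeNilpotentLie d N :=
  sum_mem fun i _ => smul_letter_mem (c i) i

theorem vecTensor_apply (c : Fin d → ℝ) (w : Word d N) :
    vecTensor N c w = ∑ i, c i * if w.1 = [i] then 1 else 0 := by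
  rw [vecTensor, sum_apply]; rfl

theorem vecTensor_smul (r : ℝ) (c : Fin d → ℝ) :
    vecTensor N (fun i => r * c i) = r • vecTensor N c := by
  simp only [vecTensor, Finset.smul_sum, smul_smul]

theorem mul_vecTensor_apply_append (a : TruncTensor d N) (c : Fin d → ℝ) (l : List (Fin d))
    (i : Fin d) (h : (l ++ [i]).length ≤ N) :
    (a * vecTensor N c) ⟨l ++ [i], h⟩ =
      a ⟨l, by rw [List.length_append] at h; exact (Nat.le_add_right _ _).trans h⟩ * c i := by
  rw [mul_apply, Finset.sum_eq_single l.length]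
  · simp [Word.take, Word.drop, vecTensor_apply]
  · intro j hj hjl
    rw [Finset.mem_range, List.length_append, List.length_singleton] at hj
    rw [vecTensor_apply, Finset.sum_eq_zero, mul_zero]
    intro k _
    rw [if_neg, mul_zero]
    intro hk
    have := congrArg List.length hk
    simp only [Word.drop, List.length_drop, List.length_append, List.length_singleton] at this
    omega
  · intro hl
    exact absurd (Finset.mem_range.2 (by simp)) hl

theorem mul_vecTensor_apply_nil (a : TruncTensor d N) (c : Fin d → ℝ)
    (h : ([] : List (Fin d)).length ≤ N) :
    (a * vecTensor N c) ⟨[], h⟩ = 0 := by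
  simp [mul_apply, Word.drop, vecTensor_apply]

/-- The signature of a path over `[0, τ]`, as a function of `τ ∈ ℝ` (constant outside
`[0, 1]`) with values in the group `1 + 𝔱^N`. -/
noncomputable def sigFun (N : ℕ) (x : BV d) (τ : ℝ) : UnitTensor d N :=
  ⟨signature N x 0 (Set.projIcc 0 1 zero_le_one τ), rfl⟩

theorem sigFun_apply (x : BV d) (τ : ℝ) (w : Word d N) :
    (sigFun N x τ).1 w = iterFun x w.1.reverse τ := rfl

theorem sigFun_apply_append (x : BV d) (τ : ℝ) (l : List (Fin d)) (i : Fin d)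
    (h : (l ++ [i]).length ≤ N) :
    (sigFun N x τ).1 ⟨l ++ [i], h⟩ = iterFun x (i :: l.reverse) τ := by
  rw [sigFun_apply, List.reverse_append, List.reverse_singleton, List.singleton_append]

theorem sigFun_one (x : BV d) : (sigFun N x 1).1 = signature N x 0 1 := by
  rw [sigFun, Set.projIcc_right]
  rfl

theorem sigFun_zero (x : BV d)
    (hx : AbsolutelyContinuousOnInterval (Set.IccExtend zero_le_one x.1) 0 1) :
    sigFun N x 0 = 1 := by
  refine Subtype.ext (ext_apply fun w => ?_)
  obtain ⟨w, hw⟩ := w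
  rcases List.eq_nil_or_concat' w with rfl | ⟨l, i, rfl⟩
  · rw [sigFun_apply]; rfl
  · rw [sigFun_apply_append, iterFun_cons x hx i _ (Set.left_mem_Icc.2 zero_le_one),
      intervalIntegral.integral_same, one_val, one_apply, if_neg (by simp)]

theorem intervalIntegrable_iterFun_mul_deriv (x : BV d)
    (hx : AbsolutelyContinuousOnInterval (Set.IccExtend zero_le_one x.1) 0 1)
    (i : Fin d) (w : List (Fin d)) :
    IntervalIntegrable (fun u => iterFun x w u * deriv (coordExt x.1 i) u) volume 0 1 :=
  (absolutelyContinuous_coordExt hx i).intervalIntegrable_deriv.continuousOn_mul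
    (continuous_iterFun x hx w).continuousOn

theorem coordAC_sigFun (x : BV d)
    (hx : AbsolutelyContinuousOnInterval (Set.IccExtend zero_le_one x.1) 0 1) :
    CoordAC fun τ => (sigFun N x τ).1 := by
  rintro ⟨w, hw⟩
  rcases List.eq_nil_or_concat' w with rfl | ⟨l, i, rfl⟩
  · exact absolutelyContinuous_const (1 : ℝ) 0 1
  · simp only [sigFun_apply_append]
    refine absolutelyContinuous_congr ((intervalIntegrable_iterFun_mul_deriv x hx i
      l.reverse).absolutelyContinuousOnInterval_intervalIntegral Set.left_mem_uIcc) fun t ht => ?_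
    rw [Set.uIcc_of_le zero_le_one] at ht
    exact (iterFun_cons x hx i _ ht).symm

/-- The signature solves the linear differential equation `S' = S ⊗ x'`. -/
theorem hasDerivAt_sigFun (x : BV d)
    (hx : AbsolutelyContinuousOnInterval (Set.IccExtend zero_le_one x.1) 0 1) :
    ∀ᵐ s, s ∈ Set.uIcc (0 : ℝ) 1 →
    HasDerivAt (fun r => (sigFun N x r).1)
      ((sigFun N x s).1 * vecTensor N fun i => deriv (coordExt x.1 i) s) s := by
  have h : ∀ (i : Fin d) (w : Word d N), ∀ᵐ s, s ∈ Set.uIcc (0 : ℝ) 1 →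
      ∀ c ∈ Set.uIcc (0 : ℝ) 1, HasDerivAt
        (fun r => ∫ u in c..r, iterFun x w.1.reverse u * deriv (coordExt x.1 i) u)
        (iterFun x w.1.reverse s * deriv (coordExt x.1 i) s) s :=
    fun i w => (intervalIntegrable_iterFun_mul_deriv x hx i w.1.reverse).ae_hasDerivAt_integral
  have h' := ae_all_iff.2 fun i => ae_all_iff.2 (h i)
  filter_upwards [h', Measure.ae_ne volume (0 : ℝ), Measure.ae_ne volume (1 : ℝ)]
    with s hs h0 h1 hmem
  rw [Set.uIcc_of_le zero_le_one] at hmem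
  have hnhds : Set.Icc (0 : ℝ) 1 ∈ nhds s :=
    Icc_mem_nhds (lt_of_le_of_ne hmem.1 h0.symm) (lt_of_le_of_ne hmem.2 h1)
  rw [hasDerivAt_iff]
  rintro ⟨w, hw⟩
  rcases List.eq_nil_or_concat' w with rfl | ⟨l, i, rfl⟩
  · rw [mul_vecTensor_apply_nil]; exact hasDerivAt_const s (1 : ℝ)
  · rw [mul_vecTensor_apply_append]
    simp only [sigFun_apply_append]
    refine (hs i ⟨l, _⟩ (Set.uIcc_of_le (zero_le_one (α := ℝ)) ▸ hmem) 0
      Set.left_mem_uIcc).congr_of_eventuallyEq ?_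
    filter_upwards [hnhds] with t ht using iterFun_cons x hx i _ ht

/-- The signature of an absolutely continuous path has logarithmic derivative in `𝔤^N`. -/
theorem logEuler_sigFun_mem (x : BV d)
    (hx : AbsolutelyContinuousOnInterval (Set.IccExtend zero_le_one x.1) 0 1) :
    logEuler (sigFun N x 1) ∈ freeNilpotentLie d N := by
  refine logEuler_mem_of_hasDerivAt (coordAC_sigFun x hx)
    (by rw [sigFun_zero x hx, logEuler_one]; exact zero_mem _) ?_ Set.right_mem_uIcc
  filter_upwards [hasDerivAt_sigFun (N := N) x hx] with s hs hmem
  exact ⟨_, vecTensor_mem _, hs hmem⟩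

/-- If the path moves with constant velocity `r c` during a time interval of length `1 / r`, then
its signature is multiplied by `exp c`. -/
theorem sigFun_eq_mul_texp (x : BV d)
    (hx : AbsolutelyContinuousOnInterval (Set.IccExtend zero_le_one x.1) 0 1)
    {a b r : ℝ} (ha : 0 ≤ a) (hab : a ≤ b) (hb : b ≤ 1)
    (hr : r * (b - a) = 1) (c : Fin d → ℝ)
    (h : ∀ᵐ s, s ∈ Set.Icc a b → ∀ i, deriv (coordExt x.1 i) s = r * c i) :
    (sigFun N x b).1 = (sigFun N x a).1 * texp (vecTensor N c) := by
  have hc := mem_degGE_one_of_mem (vecTensor_mem (N := N) c)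
  set v := vecTensor N c with hv
  have hsub : Set.uIcc a b ⊆ Set.uIcc (0 : ℝ) 1 := by
    rw [Set.uIcc_of_le hab, Set.uIcc_of_le zero_le_one]; exact Set.Icc_subset_Icc ha hb
  -- the function `S ⊗ exp (- r (s - a) c)` has derivative zero on the interval
  let e : ℝ → TruncTensor d N := fun s => texp ((r * (s - a)) • -v)
  have he : ∀ s, HasDerivAt e (-(r • (e s * v))) s := by
    intro s
    have h1 : HasDerivAt (fun s => r * (s - a)) r s := by
      simpa using ((hasDerivAt_id s).sub_const a).const_mul r
    have h2 := (hasDerivAt_texp_smul (neg_mem hc) (r * (s - a))).scomp s h1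
    convert! h2 using 1
    rw [mul_neg, smul_neg]
  have heAC : CoordAC e := by
    have h1 : CoordAC fun s : ℝ => (r * (s - a)) • -v := fun w =>
      ContDiffOn.absolutelyContinuousOnInterval (f := fun s : ℝ => (r * (s - a)) * (-v) w)
        ((contDiff_const.mul (contDiff_id.sub contDiff_const)).mul contDiff_const).contDiffOn
    simp only [e, texp_eq_sum]
    exact CoordAC.sum fun k _ => fun w => ((h1.pow k) w).const_mul ((k.factorial : ℝ)⁻¹)
  have hae : ∀ᵐ s, s ∈ Set.uIcc a b →
      HasDerivAt (fun s => (sigFun N x s).1 * e s) 0 s := by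
    filter_upwards [h, hasDerivAt_sigFun (N := N) x hx] with s hs hd hmem
    have hd' := hd (hsub hmem)
    rw [Set.uIcc_of_le hab] at hmem
    have hvel : (vecTensor N fun i => deriv (coordExt x.1 i) s) = r • v := by
      simp only [hs hmem, vecTensor_smul, hv]
    rw [hvel] at hd'
    convert! hasDerivAt_mul hd' (he s) using 1
    have hcomm : Commute (e s) v :=
      commute_texp ((Commute.neg_left (Commute.refl v)).smul_left _)
    rw [hcomm.eq, mul_smul_comm, smul_mul_assoc, mul_neg, mul_smul_comm, mul_assoc,
      add_neg_cancel]
  have hconst : (sigFun N x b).1 * e b = (sigFun N x a).1 * e a := by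
    refine ext_apply fun w => ?_
    obtain ⟨C, hC⟩ := ((((coordAC_sigFun x hx).mul heAC) w).mono hsub).const_of_ae_hasDerivAt_zero
      (by
        filter_upwards [hae] with s hs hmem
        exact hasDerivAt_iff.1 (hs hmem) w)
    exact (hC b Set.right_mem_uIcc).trans (hC a Set.left_mem_uIcc).symm
  have ea : e a = 1 := by simp [e, texp_zero]
  have eb : e b = texp (-v) := by simp [e, hr]
  rw [ea, eb, mul_one] at hconst
  rw [← hconst, mul_assoc, texp_neg_mul_texp hc, mul_one]

theorem intervalIntegrable_of_bounded {c : ℝ → EuclideanSpace ℝ (Fin d)} {C : NNReal}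
    (hc : Measurable c) (hb : ∀ t, ‖c t‖ ≤ C) (a b : ℝ) : IntervalIntegrable c volume a b :=
  (intervalIntegrable_const (c := (C : ℝ))).mono_fun hc.aestronglyMeasurable
    (Filter.Eventually.of_forall fun t => (hb t).trans (le_abs_self _))

/-- The path `t ↦ ∫_0^t c` with the velocity `c`. -/
noncomputable def pathOfVelocity (c : ℝ → EuclideanSpace ℝ (Fin d)) {C : NNReal}
    (hc : Measurable c) (hb : ∀ t, ‖c t‖ ≤ C) : Path d where
  toFun t := ∫ u in (0 : ℝ)..t, c u
  continuous_toFun :=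
    (intervalIntegral.continuous_primitive (intervalIntegrable_of_bounded hc hb) 0).comp
      continuous_subtype_val

section

variable {c : ℝ → EuclideanSpace ℝ (Fin d)} {C : NNReal} (hc : Measurable c)
  (hb : ∀ t, ‖c t‖ ≤ C)

theorem lipschitzWith_pathOfVelocity :
    LipschitzWith C (Set.IccExtend zero_le_one (pathOfVelocity c hc hb)) := by
  have h : LipschitzWith C (pathOfVelocity c hc hb) := LipschitzWith.of_dist_le_mul fun s t => by
    have hi := intervalIntegrable_of_bounded hc hb
    have : pathOfVelocity c hc hb s - pathOfVelocity c hc hb t = ∫ u in (t : ℝ)..s, c u :=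
      intervalIntegral.integral_interval_sub_left (hi 0 s) (hi 0 t)
    rw [dist_eq_norm, this, Subtype.dist_eq, Real.dist_eq]
    exact intervalIntegral.norm_integral_le_of_norm_le_const fun u _ => hb u
  have h2 := h.comp (LipschitzWith.projIcc zero_le_one)
  rwa [mul_one] at h2

theorem pathOfVelocity_mem_H1 : pathOfVelocity c hc hb ∈ H1 d := by
  have hL := lipschitzWith_pathOfVelocity hc hb
  refine ⟨intervalIntegral.integral_same, hL.lipschitzOnWith.absolutelyContinuousOnInterval, ?_⟩
  exact MemLp.of_bound (aestronglyMeasurable_deriv _ _) C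
    (Filter.Eventually.of_forall fun t => norm_deriv_le_of_lipschitz hL)

theorem deriv_coordExt_pathOfVelocity : ∀ᵐ s, s ∈ Set.uIcc (0 : ℝ) 1 → ∀ i,
    deriv (coordExt (pathOfVelocity c hc hb) i) s = c s i := by
  filter_upwards [(intervalIntegrable_of_bounded hc hb 0 1).ae_hasDerivAt_integral,
    Measure.ae_ne volume (0 : ℝ), Measure.ae_ne volume (1 : ℝ)] with s hs h0 h1 hmem i
  have hd := hs hmem 0 Set.left_mem_uIcc
  rw [Set.uIcc_of_le zero_le_one] at hmem
  have hnhds : Set.Icc (0 : ℝ) 1 ∈ nhds s :=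
    Icc_mem_nhds (lt_of_le_of_ne hmem.1 h0.symm) (lt_of_le_of_ne hmem.2 h1)
  have hd' : HasDerivAt (Set.IccExtend zero_le_one (pathOfVelocity c hc hb)) (c s) s := by
    refine hd.congr_of_eventuallyEq ?_
    filter_upwards [hnhds] with t ht
    rw [Set.IccExtend_of_mem _ _ ht]
    rfl
  exact ((EuclideanSpace.proj i : EuclideanSpace ℝ (Fin d) →L[ℝ] ℝ).hasFDerivAt.comp_hasDerivAt
    s hd').deriv

end

/-- A path which moves with constant velocity on each of `m` time intervals of length `1 / m`
has as signature the product of the exponentials of its increments. -/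
theorem exists_sigFun_eq_prod (a : ℕ → EuclideanSpace ℝ (Fin d)) {C : NNReal}
    (ha : ∀ j, ‖a j‖ ≤ C) {m : ℕ} (hm : 0 < m) :
    ∃ (x : Path d) (hx : x ∈ H1 d), (sigFun N ⟨x, H1_subset_BV d hx⟩ 1).1 =
      ((List.range m).map fun j => texp (vecTensor N (a j))).prod := by
  have hm0 : (0 : ℝ) < m := by exact_mod_cast hm
  let c : ℝ → EuclideanSpace ℝ (Fin d) := fun t => (m : ℝ) • a ⌊m * t⌋₊
  have hc : Measurable c :=
    ((measurable_from_nat (f := a)).comp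
      (Nat.measurable_floor.comp (measurable_id.const_mul (m : ℝ)))).const_smul (m : ℝ)
  have hb : ∀ t, ‖c t‖ ≤ (m * C : NNReal) := fun t => by
    rw [norm_smul, Real.norm_natCast]
    push_cast
    exact mul_le_mul_of_nonneg_left (ha _) hm0.le
  obtain ⟨x, hx, hderiv⟩ : ∃ x : Path d, ∃ _ : x ∈ H1 d, ∀ᵐ s, s ∈ Set.uIcc (0 : ℝ) 1 → ∀ i,
      deriv (coordExt x i) s = c s i :=
    ⟨_, pathOfVelocity_mem_H1 hc hb, deriv_coordExt_pathOfVelocity hc hb⟩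
  have hac : AbsolutelyContinuousOnInterval (Set.IccExtend zero_le_one x) 0 1 := hx.2.1
  refine ⟨x, hx, ?_⟩
  have key : ∀ j, j ≤ m → (sigFun N ⟨x, H1_subset_BV d hx⟩ (j / m)).1 =
      ((List.range j).map fun j => texp (vecTensor N (a j))).prod := by
    intro j
    induction j with
    | zero =>
      intro _
      rw [Nat.cast_zero, zero_div, sigFun_zero ⟨x, H1_subset_BV d hx⟩ hac, one_val,
        List.range_zero, List.map_nil, List.prod_nil]
    | succ j ih =>
      intro hj
      rw [List.range_succ, List.map_append, List.prod_append, ← ih (by omega),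
        List.map_singleton, List.prod_singleton, Nat.cast_succ]
      have hj' : (j : ℝ) + 1 ≤ m := by exact_mod_cast hj
      have ha0 : (0 : ℝ) ≤ j / m := by positivity
      have hb1 : ((j : ℝ) + 1) / m ≤ 1 := by rwa [div_le_one hm0]
      have hab : (j : ℝ) / m ≤ (j + 1) / m := by gcongr; linarith
      have hr : (m : ℝ) * ((j + 1) / m - j / m) = 1 := by field_simp; ring
      have hd : ∀ᵐ s, s ∈ Set.Icc ((j : ℝ) / m) ((j + 1) / m) → ∀ i,
          deriv (coordExt x i) s = m * a j i := by
        filter_upwards [hderiv, Measure.ae_ne volume (((j : ℝ) + 1) / m)] with s hs hne hmem i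
        have hlt := lt_of_le_of_ne hmem.2 hne
        have h1 : (j : ℝ) ≤ m * s := by
          have := hmem.1; rw [div_le_iff₀ hm0] at this; linarith
        have h2 : m * s < j + 1 := by
          rw [lt_div_iff₀ hm0] at hlt; linarith
        have hfl : ⌊m * s⌋₊ = j :=
          (Nat.floor_eq_iff (h1.trans' j.cast_nonneg)).2 ⟨h1, h2⟩
        have hs01 : s ∈ Set.uIcc (0 : ℝ) 1 := by
          rw [Set.uIcc_of_le zero_le_one]
          exact ⟨ha0.trans hmem.1, hmem.2.trans hb1⟩
        rw [hs hs01 i]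
        change ((m : ℝ) • a ⌊m * s⌋₊) i = m * a j i
        rw [hfl]; rfl
      exact sigFun_eq_mul_texp ⟨x, H1_subset_BV d hx⟩ hac ha0 hab hb1 hr (a j) hd
  have := key m le_rfl
  rwa [div_self hm0.ne'] at this

theorem exists_list_of_mem_segmentGroup {g : UnitTensor d N} (hg : g ∈ segmentGroup d N) :
    ∃ l : List (ℝ × Fin d), g.1 = (l.map fun p => texp (p.1 • letter p.2)).prod := by
  induction hg using Subgroup.closure_induction_right with
  | one => exact ⟨[], rfl⟩
  | mul_right x _ y hy ih =>
    obtain ⟨c, i, hc⟩ := hy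
    obtain ⟨l, hl⟩ := ih
    exact ⟨l ++ [(c, i)], by simp [mul_val, hl, hc]⟩
  | mul_inv_cancel x _ y hy ih =>
    obtain ⟨c, i, hc⟩ := hy
    obtain ⟨l, hl⟩ := ih
    have h1 : y = uexp (c • letter i) (mem_degGE_one_of_mem (smul_letter_mem c i)) :=
      Subtype.ext hc
    refine ⟨l ++ [(-c, i)], ?_⟩
    rw [mul_val, h1, uexp_inv, uexp_val, hl, ← neg_smul]
    simp

/-- Every product of exponentials of letters is the signature of a piecewise linear path. -/
theorem exists_path_of_mem_segmentGroup {g : UnitTensor d N} (hg : g ∈ segmentGroup d N) :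
    ∃ (x : Path d) (hx : x ∈ H1 d), g.1 = signature N ⟨x, H1_subset_BV d hx⟩ 0 1 := by
  obtain ⟨l, hl⟩ := exists_list_of_mem_segmentGroup hg
  -- one more time interval, on which the path rests, makes the number of intervals positive
  let a : ℕ → EuclideanSpace ℝ (Fin d) := fun j =>
    (l[j]?).elim 0 fun p => EuclideanSpace.single p.2 p.1
  have ha : ∀ j, ‖a j‖ ≤ ((l.map fun p => ‖p.1‖₊).sum : NNReal) := by
    intro j
    rcases h : l[j]? with _ | p
    · simp [a, h]
    · simp only [a, h, Option.elim_some, PiLp.norm_single]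
      have hp : p ∈ l := List.mem_of_getElem? h
      have := List.single_le_sum (l := l.map fun p => ‖p.1‖₊) (fun _ _ => zero_le) _
        (List.mem_map_of_mem hp)
      exact NNReal.coe_le_coe.2 this
  obtain ⟨x, hx, h⟩ := exists_sigFun_eq_prod (N := N) a ha l.length.succ_pos
  refine ⟨x, hx, ?_⟩
  rw [← sigFun_one, h, hl, List.range_succ, List.map_append, List.prod_append]
  have hlast : texp (vecTensor N (a l.length)) = 1 := by
    have : vecTensor N (a l.length) = 0 := by simp [vecTensor, a]
    rw [this, texp_zero]
  rw [List.map_singleton, List.prod_singleton, hlast, mul_one]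
  congr 1
  refine List.ext_getElem (by simp) fun j h1 h2 => ?_
  simp only [List.length_map] at h1
  simp only [List.getElem_map, List.getElem_range]
  congr 1
  simp [vecTensor, a, h1]

end

/-! ### The Lie group structure -/

section

/-- A subgroup of a Lie group which corresponds to a linear subspace in a global chart is a closed
Lie subgroup. -/
theorem isClosedLieSubgroup_of_globalChart {E G : Type*} [NormedAddCommGroup E] [NormedSpace ℝ E]
    [FiniteDimensional ℝ E] [Group G] [TopologicalSpace G] [ChartedSpace E G]
    [LieGroup 𝓘(ℝ, E) ∞ G] (Φ : G ≃ₜ E) (hΦ : ContMDiff 𝓘(ℝ, E) 𝓘(ℝ, E) ∞ Φ)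
    (hΦ' : ContMDiff 𝓘(ℝ, E) 𝓘(ℝ, E) ∞ Φ.symm) (V : Submodule ℝ E) (S : Subgroup G)
    (hS : ∀ g, g ∈ S ↔ Φ g ∈ V) : IsClosedLieSubgroup 𝓘(ℝ, E) S := by
  have : IsManifold 𝓘(ℝ, E) ∞ G := (inferInstance : ContMDiffMul 𝓘(ℝ, E) ∞ G).toIsManifold
  obtain ⟨F, hF⟩ := V.exists_isCompl
  let e : V ≃L[ℝ] EuclideanSpace ℝ (Fin (Module.finrank ℝ V)) :=
    ContinuousLinearEquiv.ofFinrankEq (by simp)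
  let q : (EuclideanSpace ℝ (Fin (Module.finrank ℝ V)) × F) ≃L[ℝ] E :=
    (e.symm.prodCongr (ContinuousLinearEquiv.refl ℝ F)).trans
      (V.prodEquivOfIsCompl F hF).toContinuousLinearEquiv
  have hq : ∀ v, q (v, 0) = e.symm v := fun v => by simp [q]
  -- the chart of the subgroup
  let Ψ : S ≃ₜ EuclideanSpace ℝ (Fin (Module.finrank ℝ V)) :=
    { toFun := fun g => e ⟨Φ g, (hS g).1 g.2⟩
      invFun := fun v => ⟨Φ.symm (e.symm v), (hS _).2 (by simp)⟩
      left_inv := fun g => by simp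
      right_inv := fun v => by simp
      continuous_toFun :=
        e.continuous.comp ((Φ.continuous.comp continuous_subtype_val).subtype_mk _)
      continuous_invFun := (Φ.symm.continuous.comp
        (continuous_subtype_val.comp e.symm.continuous)).subtype_mk _ }
  have hΨval : ∀ g : S, (g : G) = Φ.symm (e.symm (Ψ g)) := fun g => by simp [Ψ]
  have hΨq : ∀ g : S, Ψ g = (q.symm (Φ g)).1 := fun g => by
    have : Φ g = q (Ψ g, 0) := by rw [hq]; simp [Ψ]
    rw [this, q.symm_apply_apply]
  let _ : ChartedSpace (EuclideanSpace ℝ (Fin (Module.finrank ℝ V))) S :=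
    Ψ.isOpenEmbedding.singletonChartedSpace
  have hmanifold : IsManifold (𝓡 (Module.finrank ℝ V)) ∞ S :=
    Ψ.isOpenEmbedding.isManifold_singleton
  have hΨ : ContMDiff (𝓡 (Module.finrank ℝ V)) (𝓡 (Module.finrank ℝ V)) ∞ Ψ :=
    contMDiff_isOpenEmbedding Ψ.isOpenEmbedding
  have hval : ContMDiff (𝓡 (Module.finrank ℝ V)) 𝓘(ℝ, E) ∞ (Subtype.val : S → G) := by
    have h1 : ContDiff ℝ ∞ fun v : EuclideanSpace ℝ (Fin (Module.finrank ℝ V)) =>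
        ((e.symm v : V) : E) := V.subtypeL.contDiff.comp e.symm.contDiff
    exact (hΦ'.comp (h1.contMDiff.comp hΨ)).congr fun g => hΨval g
  -- a map into the subgroup is smooth if it is smooth as a map into the group
  have hlift : ∀ {E' H' M : Type _} [NormedAddCommGroup E'] [NormedSpace ℝ E']
      [TopologicalSpace H'] {I' : ModelWithCorners ℝ E' H'} [TopologicalSpace M]
      [ChartedSpace H' M] {f : M → S}, ContMDiff I' 𝓘(ℝ, E) ∞ (fun x => (f x : G)) →
      ContMDiff I' (𝓡 (Module.finrank ℝ V)) ∞ f := by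
    intro E' H' M _ _ _ I' _ _ f hf
    refine ContMDiff.of_comp_isOpenEmbedding Ψ.isOpenEmbedding ?_
    have h1 : ContDiff ℝ ∞ fun a : E => (q.symm a).1 :=
      contDiff_fst.comp q.symm.contDiff
    exact (h1.contMDiff.comp (hΦ.comp hf)).congr fun x => hΨq (f x)
  refine ⟨?_, Module.finrank ℝ V, inferInstance, ?_, ?_, Topology.IsEmbedding.subtypeVal⟩
  · have : (S : Set G) = Φ ⁻¹' (V : Set E) := Set.ext hS
    rw [this]
    exact V.closed_of_finiteDimensional.preimage Φ.continuous
  · exact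
      { hmanifold with
        contMDiff_mul := hlift ((hval.comp contMDiff_fst).mul (hval.comp contMDiff_snd))
        contMDiff_inv := hlift hval.inv }
  · refine Manifold.IsImmersionOfComplement.isImmersion (F := F) fun g => ?_
    refine Manifold.IsImmersionAtOfComplement.mk_of_charts q Ψ.toOpenPartialHomeomorph
      Φ.toOpenPartialHomeomorph (Set.mem_univ _) (Set.mem_univ _) ?_ ?_
      (fun _ _ => Set.mem_univ _) ?_
    · refine Ψ.toOpenPartialHomeomorph.mem_maximalAtlas_of_contMDiffOn hΨ.contMDiffOn
        (ContMDiff.contMDiffOn (f := Ψ.symm) ?_)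
      refine ContMDiff.of_comp_isOpenEmbedding Ψ.isOpenEmbedding ?_
      exact contMDiff_id.congr Ψ.apply_symm_apply
    · exact Φ.toOpenPartialHomeomorph.mem_maximalAtlas_of_contMDiffOn hΦ.contMDiffOn
        hΦ'.contMDiffOn
    · intro v _
      change Φ (Ψ.symm v) = q (v, 0)
      rw [hq]
      exact Φ.apply_symm_apply _

open TruncTensor UnitTensor

variable {d N : ℕ}

namespace UnitTensor

/-- The logarithm, as a global chart of `1 + 𝔱^N(ℝ^d)`. -/
noncomputable def logHomeo (d N : ℕ) : UnitTensor d N ≃ₜ tangentSpace d N where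
  toFun g := ⟨tlog (g.1 - 1), mem_degGE_one.1 (tlog_mem (sub_one_mem g))⟩
  invFun a := uexp a.1 (mem_degGE_one.2 a.2)
  left_inv g := Subtype.ext (by
    rw [uexp_val, texp_tlog (sub_one_mem g), add_sub_cancel])
  right_inv a := Subtype.ext (by
    simp only [uexp_val]
    exact tlog_texp (mem_degGE_one.2 a.2))
  continuous_toFun :=
    (contDiff_tlog.continuous.comp (continuous_subtype_val.sub continuous_const)).subtype_mk _
  continuous_invFun := (contDiff_texp.continuous.comp continuous_subtype_val).subtype_mk _

theorem contMDiff_logHomeo :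
    ContMDiff 𝓘(ℝ, tangentSpace d N) 𝓘(ℝ, tangentSpace d N) ∞ (logHomeo d N) := by
  have h : ContDiff ℝ ∞ fun a : TruncTensor d N =>
      LinearMap.toContinuousLinearMap (proj d N) (tlog (a - 1)) :=
    (LinearMap.toContinuousLinearMap (proj d N)).contDiff.comp
      (contDiff_tlog.comp (contDiff_id.sub contDiff_const))
  refine (h.contMDiff.comp contMDiff_toTensor).congr fun g => Subtype.ext ?_
  change tlog (g.1 - 1) = tlog (g.1 - 1) - scalarPart (tlog (g.1 - 1)) • 1
  rw [mem_degGE_one.1 (tlog_mem (sub_one_mem g)), zero_smul, sub_zero]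

theorem contMDiff_logHomeo_symm :
    ContMDiff 𝓘(ℝ, tangentSpace d N) 𝓘(ℝ, tangentSpace d N) ∞ (logHomeo d N).symm := by
  refine contMDiff_of_toTensor ?_
  have h : ContDiff ℝ ∞ fun a : tangentSpace d N => texp a.1 :=
    contDiff_texp.comp (tangentSpace d N).subtypeL.contDiff
  exact h.contMDiff

end UnitTensor

/-- The group generated by the exponentials of letters is the exponential of the free nilpotent
Lie algebra. -/
theorem mem_segmentGroup_iff_exists_texp {g : UnitTensor d N} :
    g ∈ segmentGroup d N ↔ ∃ z ∈ freeNilpotentLie d N, texp z = g.1 := by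
  constructor
  · intro hg
    obtain ⟨x, hx, h⟩ := exists_path_of_mem_segmentGroup hg
    have hg' : g = sigFun N ⟨x, H1_subset_BV d hx⟩ 1 := Subtype.ext (by rw [h, sigFun_one])
    rw [hg']
    exact exists_texp_eq_of_logEuler_mem (logEuler_sigFun_mem ⟨x, H1_subset_BV d hx⟩ hx.2.1)
  · rintro ⟨z, hz, h⟩
    have hg : g = uexp z (mem_degGE_one_of_mem hz) := Subtype.ext h.symm
    rw [hg]
    exact mem_segmentGroup_of_logEuler_mem (logEuler_uexp_mem hz)

theorem mem_segmentGroup_iff_tlog_mem {g : UnitTensor d N} :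
    g ∈ segmentGroup d N ↔ tlog (g.1 - 1) ∈ freeNilpotentLie d N := by
  rw [mem_segmentGroup_iff_exists_texp]
  constructor
  · rintro ⟨z, hz, h⟩
    rwa [← h, tlog_texp (mem_degGE_one_of_mem hz)]
  · intro h
    exact ⟨_, h, by rw [texp_tlog (sub_one_mem g), add_sub_cancel]⟩

/-- The signatures of paths in `H¹` are the products of exponentials of letters. -/
theorem toTensor_image_segmentGroup :
    toTensor '' (segmentGroup d N : Set (UnitTensor d N)) = signatureSet d N := by
  ext a
  constructor
  · rintro ⟨g, hg, rfl⟩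
    exact exists_path_of_mem_segmentGroup hg
  · rintro ⟨x, hx, rfl⟩
    refine ⟨sigFun N ⟨x, H1_subset_BV d hx⟩ 1, ?_, sigFun_one _⟩
    exact mem_segmentGroup_of_logEuler_mem (logEuler_sigFun_mem _ hx.2.1)

theorem toTensor_image_segmentGroup_eq_texp_image :
    toTensor '' (segmentGroup d N : Set (UnitTensor d N)) =
      texp '' (freeNilpotentLie d N : Set (TruncTensor d N)) := by
  ext a
  constructor
  · rintro ⟨g, hg, rfl⟩
    exact mem_segmentGroup_iff_exists_texp.1 hg
  · rintro ⟨z, hz, rfl⟩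
    exact ⟨uexp z (mem_degGE_one_of_mem hz), mem_segmentGroup_iff_exists_texp.2 ⟨z, hz, rfl⟩, rfl⟩

theorem isClosedLieSubgroup_segmentGroup (d N : ℕ) :
    IsClosedLieSubgroup 𝓘(ℝ, tangentSpace d N) (segmentGroup d N) :=
  isClosedLieSubgroup_of_globalChart (logHomeo d N) contMDiff_logHomeo contMDiff_logHomeo_symm
    ((freeNilpotentLie d N).toSubmodule.comap (tangentSpace d N).subtype) (segmentGroup d N)
    fun _ => mem_segmentGroup_iff_tlog_mem

end

end Signature

theorem mainTheorem2 (d N : ℕ) :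
    Signature.signatureSet d N =
        Signature.TruncTensor.texp ''
          (Signature.freeNilpotentLie d N : Set (Signature.TruncTensor d N)) ∧
      ∃ G : Subgroup (Signature.UnitTensor d N),
        Signature.UnitTensor.toTensor '' (G : Set (Signature.UnitTensor d N)) =
            Signature.signatureSet d N ∧
          Signature.IsClosedLieSubgroup
            (modelWithCornersSelf ℝ (Signature.tangentSpace d N)) G :=
  ⟨Signature.toTensor_image_segmentGroup.symm.trans
      Signature.toTensor_image_segmentGroup_eq_texp_image,
    Signature.segmentGroup d N, Signature.toTensor_image_segmentGroup,
    Signature.isClosedLieSubgroup_segmentGroup d N⟩
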